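/- Let $\alpha\in[1,2)$ satisfy $\frac1{2-\alpha}\notin\mathbb N$, and let $k_\alpha$ be the integer part of $\frac1{2-\alpha}$. Set $$T_0=\frac4{2-\alpha},\qquad \kappa_\alpha=\frac{2-\alpha}2,\qquad \nu_\alpha=\frac{\alpha-1}{2-\alpha}.$$ Let $J_{\nu_\alpha+1}$ be the Bessel function of the first kind of order $\nu_\alpha+1$, and let $0<j_{\nu_\alpha+1,1}<j_{\nu_\alpha+1,2}<\dots$ be its positive zeros in increasing order. Put $\lambda_{\alpha,0}=0$ and $\lambda_{\alpha,n}=\kappa_\alpha^2\,j_{\nu_\alpha+1,n}^2$ for $n\ge1$. For $n\in\mathbb Z$ define $$\omega_{\alpha,n}=\begin{cases}-\sqrt{\lambda_{\alpha,|n|}}, & n\le-1,\\ 0, & n=0,\\ \sqrt{\lambda_{\alpha,n}}, & n\ge1.\end{cases}$$ Then there exist real numbers $x'_1,\dots,x'_{k_\alpha}$ such that the family consisting of the functions $t\mapsto e^{i\omega_{\alpha,n}t}$ ($n\in\mathbb Z$) together with $t\mapsto e^{ix'_jt}$ ($1\le j\le k_\alpha$) is a Riesz basis of $L^2(0,T_0;\mathbb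 C)$, that is, the image of an orthonormal basis under a bounded linear operator with bounded inverse. Consequently $(e^{i\omega_{\alpha,n}t})_{n\in\mathbb Z}$ has deficiency $k_\alpha$ in $L^2(0,T_0;\mathbb C)$: its closed linear span has codimension $k_\alpha$. -/

import Mathlib

open MeasureTheory

noncomputable section

namespace DegenerateWave

/-- The Bessel function of the first kind and of real order `ν`, on the half line `y > 0`. -/
def besselJ (ν y : ℝ) : ℝ :=
  ∑' m : ℕ, ((-1 : ℝ) ^ m / ((m.factorial : ℝ) * Real.Gamma ((m : ℝ) + ν + 1))) *
    (y / 2) ^ (2 * (m : ℝ) + ν)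

/-- For `n ≥ 1`, `besselZero ν n` is the `n`-th positive zero of `besselJ ν` in increasing order:
the first zero after the previous one. The value `0` at the index `n = 0` only starts the
recursion. -/
def besselZero (ν : ℝ) : ℕ → ℝ
  | 0 => 0
  | n + 1 => sInf {y : ℝ | besselZero ν n < y ∧ besselJ ν y = 0}

/-- `κ_α = (2 - α) / 2`. -/
def kappa (α : ℝ) : ℝ := (2 - α) / 2

/-- `ν_α = (α - 1) / (2 - α)`, for `α ∈ [1, 2)`. -/
def nu (α : ℝ) : ℝ := (α - 1) / (2 - α)

/-- The eigenvalues `λ_{α,n}`, for `α ∈ [1, 2)`: `λ_{α,0} = 0`, and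
`λ_{α,n} = κ_α² (j_{ν_α + 1, n})²` for `n ≥ 1`. -/
def eigenvalue (α : ℝ) (n : ℕ) : ℝ :=
  if n = 0 then 0 else kappa α ^ 2 * besselZero (nu α + 1) n ^ 2

/-- The frequencies `ω_{α,n}`, `n ∈ ℤ`: the odd extension of `n ↦ √λ_{α,n}`. -/
def omega (α : ℝ) (n : ℤ) : ℝ :=
  if n < 0 then -√(eigenvalue α n.natAbs)
  else if n = 0 then 0
  else √(eigenvalue α n.natAbs)

/-- The time `T₀ = 4 / (2 - α)`. -/
def T0 (α : ℝ) : ℝ := 4 / (2 - α)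

/-- The complex Hilbert space `L²(0, T; ℂ)`. -/
abbrev L2 (T : ℝ) : Type := Lp ℂ 2 (volume.restrict (Set.Ioo (0 : ℝ) T))

theorem memLp_exp (T w : ℝ) :
    MemLp (fun t : ℝ => Complex.exp (Complex.I * ((w * t : ℝ) : ℂ))) 2
      (volume.restrict (Set.Ioo (0 : ℝ) T)) := by
  refine MemLp.of_bound (Continuous.aestronglyMeasurable (by fun_prop)) 1
    (Filter.Eventually.of_forall fun t => ?_)
  rw [Complex.norm_exp_I_mul_ofReal]

/-- The exponential `t ↦ e^{iwt}` as an element of `L²(0, T; ℂ)`. -/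
def expL2 (T w : ℝ) : L2 T := (memLp_exp T w).toLp _

/-- A family in a complex Hilbert space is a Riesz basis if it is the image of an orthonormal
(Hilbert) basis under a bounded linear operator with bounded inverse. -/
def IsRieszBasis {ι H : Type*} [NormedAddCommGroup H] [InnerProductSpace ℂ H]
    (f : ι → H) : Prop :=
  ∃ (b : HilbertBasis ι ℂ H) (S : H ≃L[ℂ] H), ∀ i, f i = S (b i)

/-- A family has deficiency `k` if its closed linear span has codimension `k`. -/
def HasDeficiency {ι H : Type*} [NormedAddCommGroup H] [InnerProductSpace ℂ H]
    (f : ι → H) (k : ℕ) : Prop :=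
  Module.rank ℂ (H ⧸ (Submodule.span ℂ (Set.range f)).topologicalClosure) = (k : Cardinal)

end DegenerateWave

end

/-!
Put `μ = ν_α + 1 = 1/(2 - α)`, so that `T₀ = 4μ`, `k = ⌊μ⌋` and `κ_α = 1/(2μ)`. McMahon's
asymptotics `j_{μ,n} = (n + μ/2 - 1/4) π + O(1/n)` say that, in units of `2π/T₀`, the frequencies
are `±(n + k/2 + δ) + O(1/n)`, where `δ = (μ - k)/2 - 1/4`. Since `μ` is not an integer,
`|δ| < 1/4`. Numbering the negative frequencies by `n < -k` leaves a gap of exactly `k` indices, and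
the whole family is then, after multiplication by the unimodular function with frequency `k/2`, a
perturbation of `e^{i(n ± δ)t}`, with the sign constant on `n ≥ 0` and on `n < 0`.

*Riesz bases.* For such a step sequence Kadec's theorem is immediate
(`exists_operator_shifted_exp`): with `θ = 2π/T₀ (t - T₀/2) ∈ (-π, π)` and `P` the diagonal operator
of signs, the operator `cos (δθ) + i sin (δθ) P` is at distance at most
`1 - cos (πδ) + sin (π|δ|) < 1` from the identity. An `ℓ²` perturbation of the frequencies is a
Hilbert–Schmidt perturbation of the operator, small after finitely many frequencies are reset
(`exists_isRieszBasis_of_tail`). Finitely many frequencies may be exchanged for any others that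
keep them distinct (`IsRieszBasis.replace_frequencies`): if the functional biorthogonal to the
member with frequency `λ` killed the exponential with a new frequency `a`, then multiplying its
Fourier transform by `(x - λ)/(x - a)` would give a functional vanishing on the whole basis. So
`k` arbitrary new frequencies fill the gap, and the deficiency is read off from the Riesz basis.

*Zeros.* Poisson's integral and a contour shift into the half strip `|Re z| ≤ 1`, `Im z ≥ 0` give
`√x J_μ(x) = C cos (x - μπ/2 - π/4) + O(1/x)`, hence the asymptotics of the zeros up to a shift of
their numbering. The shift vanishes for `1/2 < μ ≤ 3/2` by Sturm comparison of `√x J_μ` and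
`√x J_{μ-1}` with the sine, and it does not change when `μ` increases by `1` because the zeros of
`J_μ` and `J_{μ+1}` interlace (`exists_besselZero_asymptotic`).
-/

noncomputable section

namespace DegenerateWave

section Exponentials

open scoped InnerProductSpace ENNReal

/-! ### Riesz bases in Hilbert spaces -/

section RieszAbstract

variable {ι κ H : Type*} [NormedAddCommGroup H] [InnerProductSpace ℂ H]

theorem IsRieszBasis.map_equiv {f : ι → H} (hf : IsRieszBasis f) (U : H ≃L[ℂ] H) :
    IsRieszBasis fun i => U (f i) := by
  obtain ⟨b, S, h⟩ := hf
  exact ⟨b, S.trans U, fun i => by simp [h]⟩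

theorem IsRieszBasis.const_smul {f : ι → H} (hf : IsRieszBasis f) {c : ℂ} (hc : c ≠ 0) :
    IsRieszBasis fun i => c • f i :=
  hf.map_equiv (ContinuousLinearEquiv.smulLeft (Units.mk0 c hc))

theorem exists_hilbertBasis_reindex [CompleteSpace H] (b : HilbertBasis ι ℂ H) (e : κ ≃ ι) :
    ∃ b' : HilbertBasis κ ℂ H, ∀ i, b' i = b (e i) := by
  have ho : Orthonormal ℂ fun i => b (e i) := b.orthonormal.comp e e.injective
  refine ⟨HilbertBasis.mk ho ?_, fun i => by rw [HilbertBasis.coe_mk]⟩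
  have : Set.range (fun i => b (e i)) = Set.range b := e.surjective.range_comp b
  rw [this, b.dense_span]

theorem IsRieszBasis.reindex [CompleteSpace H] {f : ι → H} (hf : IsRieszBasis f) (e : κ ≃ ι) :
    IsRieszBasis fun i => f (e i) := by
  obtain ⟨b, S, h⟩ := hf
  obtain ⟨b', hb'⟩ := exists_hilbertBasis_reindex b e
  exact ⟨b', S, fun i => by simp only [h, hb']⟩

theorem exists_hilbertBasis_unit_smul [CompleteSpace H] (b : HilbertBasis ι ℂ H) {c : ι → ℂ}
    (hc : ∀ i, ‖c i‖ = 1) : ∃ b' : HilbertBasis ι ℂ H, ∀ i, b' i = c i • b i := by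
  classical
  have ho : Orthonormal ℂ fun i => c i • b i := by
    rw [orthonormal_iff_ite]
    intro i j
    rw [inner_smul_left, inner_smul_right, orthonormal_iff_ite.mp b.orthonormal]
    split_ifs with hij
    · subst hij
      rw [mul_one, ← Complex.normSq_eq_conj_mul_self, Complex.normSq_eq_norm_sq, hc]
      norm_num
    · simp
  refine ⟨HilbertBasis.mk ho ?_, fun i => by rw [HilbertBasis.coe_mk]⟩
  rw [← b.dense_span]
  refine Submodule.topologicalClosure_mono (Submodule.span_le.mpr ?_)
  rintro _ ⟨i, rfl⟩
  have hi : c i ≠ 0 := by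
    intro h0
    have := hc i
    simp [h0] at this
  have : b i = (c i)⁻¹ • (c i • b i) := by rw [smul_smul, inv_mul_cancel₀ hi, one_smul]
  rw [SetLike.mem_coe, this]
  exact Submodule.smul_mem _ _ (Submodule.subset_span ⟨i, rfl⟩)

theorem IsRieszBasis.unit_smul [CompleteSpace H] {f : ι → H} (hf : IsRieszBasis f) {c : ι → ℂ}
    (hc : ∀ i, ‖c i‖ = 1) : IsRieszBasis fun i => c i • f i := by
  obtain ⟨b, S, h⟩ := hf
  obtain ⟨b', hb'⟩ := exists_hilbertBasis_unit_smul b hc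
  exact ⟨b', S, fun i => by simp only [hb', map_smul, h]⟩

/-- Paley–Wiener stability: an operator at distance less than `1` from the identity is invertible
by the Neumann series. -/
theorem isRieszBasis_of_norm_sub_one_lt [CompleteSpace H] (b : HilbertBasis ι ℂ H) (A : H →L[ℂ] H)
    (hA : ‖A - 1‖ < 1) : IsRieszBasis fun i => A (b i) := by
  have hA' : ‖1 - A‖ < 1 := by rwa [norm_sub_rev]
  refine ⟨b, ContinuousLinearEquiv.ofUnit (Units.oneSub (1 - A) hA'), fun i => ?_⟩
  change A (b i) = (Units.oneSub (1 - A) hA' : H →L[ℂ] H) (b i)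
  simp

theorem hasSum_sq_norm_inner (b : HilbertBasis ι ℂ H) (x : H) :
    HasSum (fun i => ‖⟪b i, x⟫_ℂ‖ ^ 2) (‖x‖ ^ 2) := by
  have h := lp.hasSum_norm (p := 2) (by norm_num) (b.repr x)
  simpa [b.repr_apply_apply] using h

/-- A square summable family `d` of vectors defines a Hilbert–Schmidt operator `b i ↦ d i`. -/
theorem exists_operator_of_summable_sq [CompleteSpace H] (b : HilbertBasis ι ℂ H) (d : ι → H)
    {C : ℝ} (hd : HasSum (fun i => ‖d i‖ ^ 2) C) :
    ∃ D : H →L[ℂ] H, (∀ i, D (b i) = d i) ∧ ‖D‖ ≤ √C := by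
  classical
  have hsum : ∀ x : H, Summable (fun i => ‖⟪b i, x⟫_ℂ • d i‖) ∧
      ∑' i, ‖⟪b i, x⟫_ℂ • d i‖ ≤ √C * ‖x‖ := by
    intro x
    have hx := hasSum_sq_norm_inner b x
    have h := Real.inner_le_Lp_mul_Lq_hasSum_of_nonneg (f := fun i => ‖⟪b i, x⟫_ℂ‖)
      (g := fun i => ‖d i‖) (A := ‖x‖) (B := √C) (p := 2) (q := 2)
      (Real.HolderConjugate.two_two) (norm_nonneg _) (Real.sqrt_nonneg _)
      (fun _ => norm_nonneg _) (fun _ => norm_nonneg _) (by simpa using hx)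
      (by simpa [Real.sq_sqrt (hd.nonneg fun _ => sq_nonneg _)] using hd)
    obtain ⟨S, -, hS, hs⟩ := h
    simp_rw [norm_smul]
    exact ⟨hs.summable, by rw [hs.tsum_eq, mul_comm]; exact hS⟩
  let L : H →ₗ[ℂ] H :=
    { toFun := fun x => ∑' i, ⟪b i, x⟫_ℂ • d i
      map_add' := fun x y => by
        rw [← (hsum x).1.of_norm.tsum_add (hsum y).1.of_norm]
        simp [add_smul]
      map_smul' := fun c x => by
        simp only [inner_smul_right, mul_smul, RingHom.id_apply]
        exact ((hsum x).1.of_norm.tsum_const_smul c) }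
  refine ⟨L.mkContinuous (√C) fun x => (norm_tsum_le_tsum_norm (hsum x).1).trans (hsum x).2,
    fun i => ?_, LinearMap.mkContinuous_norm_le _ (Real.sqrt_nonneg _) _⟩
  change ∑' j, ⟪b j, b i⟫_ℂ • d j = d i
  rw [tsum_eq_single i]
  · simp [b.orthonormal.1 i]
  · intro j hj
    simp [orthonormal_iff_ite.mp b.orthonormal, hj]

/-- A family `f` that is `ℓ²`-close to `A ∘ b`, where `‖A - 1‖ < 1`, becomes a Riesz basis once
finitely many of its members are reset to those of `A ∘ b`: this makes the perturbation a
Hilbert–Schmidt operator of small norm. -/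
theorem exists_isRieszBasis_of_tail [CompleteSpace H] (b : HilbertBasis ι ℂ H) (A : H →L[ℂ] H)
    (hA : ‖A - 1‖ < 1) {f : ι → H} (hf : Summable fun i => ‖f i - A (b i)‖ ^ 2) :
    ∃ F : Finset ι, ∀ g : ι → H, (∀ i ∈ F, g i = A (b i)) → (∀ i ∉ F, g i = f i) →
      IsRieszBasis g := by
  classical
  set ε := (1 - ‖A - 1‖) / 2 with hε
  have hε0 : 0 < ε := by linarith
  obtain ⟨F, hF⟩ := ((tendsto_order.mp (tendsto_tsum_compl_atTop_zero
    fun i => ‖f i - A (b i)‖ ^ 2)).2 (ε ^ 2) (by positivity)).exists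
  refine ⟨F, fun g hg1 hg2 => ?_⟩
  have hs : HasSum (fun i => ‖g i - A (b i)‖ ^ 2)
      (∑' i : {x // x ∉ F}, ‖f i - A (b i)‖ ^ 2) := by
    have h1 : (fun i => ‖g i - A (b i)‖ ^ 2) =
        Set.indicator {x | x ∉ F} (fun i => ‖f i - A (b i)‖ ^ 2) := by
      ext i
      by_cases hi : i ∈ F
      · simp [hi, hg1]
      · simp [hi, hg2]
    rw [h1, ← hasSum_subtype_iff_indicator]
    exact (hf.subtype _).hasSum
  obtain ⟨D, hD, hDn⟩ := exists_operator_of_summable_sq b _ hs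
  have hDε : ‖D‖ ≤ ε := by
    refine hDn.trans ?_
    rw [← Real.sqrt_sq hε0.le]
    exact Real.sqrt_le_sqrt hF.le
  have h := isRieszBasis_of_norm_sub_one_lt b (A + D) (by
    calc ‖A + D - 1‖ = ‖(A - 1) + D‖ := by congr 1; abel
      _ ≤ ‖A - 1‖ + ‖D‖ := norm_add_le _ _
      _ < 1 := by linarith)
  convert! h using 2 with i
  simp [hD]

/-- The condition under which one member of a Riesz basis `S ∘ b` can be exchanged for `v`: the
coefficient of `v` along that member does not vanish. -/
theorem isRieszBasis_update [DecidableEq ι] (b : HilbertBasis ι ℂ H) (S : H ≃L[ℂ] H) (i : ι)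
    (v : H) (hv : ⟪b i, S.symm v⟫_ℂ ≠ 0) :
    IsRieszBasis (Function.update (fun j => S (b j)) i v) := by
  set c := ⟪b i, S.symm v⟫_ℂ with hc
  set w := S.symm v - b i with hw
  have hbi : ⟪b i, b i⟫_ℂ = 1 := by simp [b.orthonormal.1 i]
  have hbw : ⟪b i, w⟫_ℂ = c - 1 := by rw [hw, inner_sub_right, hbi]
  let P : H →L[ℂ] H := (innerSL ℂ (b i)).smulRight w
  have hP : ∀ x, P x = ⟪b i, x⟫_ℂ • w := fun x => by simp [P]
  let E : H ≃L[ℂ] H := ContinuousLinearEquiv.equivOfInverse (1 + P) (1 - c⁻¹ • P)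
    (fun x => by
      simp only [add_apply, sub_apply,
        one_apply_eq_self, smul_apply, hP, inner_add_right,
        inner_smul_right, hbw, smul_smul]
      have : c⁻¹ * (⟪b i, x⟫_ℂ + ⟪b i, x⟫_ℂ * (c - 1)) = ⟪b i, x⟫_ℂ := by field_simp; ring
      rw [this]; abel)
    (fun x => by
      simp only [add_apply, sub_apply,
        one_apply_eq_self, smul_apply, hP, inner_sub_right,
        inner_smul_right, hbw, smul_smul]
      have : (⟪b i, x⟫_ℂ - c⁻¹ * ⟪b i, x⟫_ℂ * (c - 1)) = c⁻¹ * ⟪b i, x⟫_ℂ := by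
        field_simp; ring
      rw [this]; abel)
  refine ⟨b, E.trans S, fun j => ?_⟩
  have hE : ∀ x, E x = x + ⟪b i, x⟫_ℂ • w := fun x => by
    change (1 + P) x = _
    simp [hP]
  rw [ContinuousLinearEquiv.trans_apply, hE]
  by_cases hj : j = i
  · subst hj
    rw [hbi]
    simp [hw]
  · simp [hj, orthonormal_iff_ite.mp b.orthonormal, Ne.symm hj]

/-- In a Riesz basis split into two parts, the second one finite, the closed span of the first part
is the common kernel of the coefficient functionals of the second part. -/
theorem IsRieszBasis.hasDeficiency {k : ℕ} {f : ι → H} {g : Fin k → H}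
    (h : IsRieszBasis (Sum.elim f g)) : HasDeficiency f k := by
  classical
  obtain ⟨b, S, hS⟩ := h
  let Φ : H →L[ℂ] (Fin k → ℂ) := ContinuousLinearMap.pi fun j =>
    (innerSL ℂ (b (Sum.inr j))).comp (S.symm : H →L[ℂ] H)
  have hΦ : ∀ x j, Φ x j = ⟪b (Sum.inr j), S.symm x⟫_ℂ := fun x j => by simp [Φ]
  have hf : ∀ i, f i = S (b (Sum.inl i)) := fun i => by simpa using hS (Sum.inl i)
  have hg : ∀ j, g j = S (b (Sum.inr j)) := fun j => by simpa using hS (Sum.inr j)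
  have hΦf : ∀ i, Φ (f i) = 0 := fun i => by
    ext j
    simp [hΦ, hf, orthonormal_iff_ite.mp b.orthonormal]
  have hΦg : ∀ l j, Φ (g l) j = if j = l then 1 else 0 := fun l j => by
    simp [hΦ, hg, orthonormal_iff_ite.mp b.orthonormal]
  have hsurj : Function.Surjective Φ := fun y => by
    refine ⟨∑ l, y l • g l, ?_⟩
    ext j
    simp [map_sum, hΦg]
  have hker : (Submodule.span ℂ (Set.range f)).topologicalClosure = Φ.ker := by
    apply le_antisymm
    · refine Submodule.topologicalClosure_minimal _ (Submodule.span_le.mpr ?_)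
        (ContinuousLinearMap.isClosed_ker Φ)
      rintro _ ⟨i, rfl⟩
      exact hΦf i
    · intro x hx
      have hx' : Φ x = 0 := hx
      have hs := (b.hasSum_repr (S.symm x)).mapL (S : H →L[ℂ] H)
      have hx2 : (S : H →L[ℂ] H) (S.symm x) = x := by simp
      rw [hx2] at hs
      refine (Submodule.isClosed_topologicalClosure _).mem_of_tendsto hs
        (Filter.Eventually.of_forall fun s => ?_)
      refine Submodule.sum_mem _ fun i _ => ?_
      rcases i with i | j
      · simp only [map_smul]
        refine Submodule.smul_mem _ _ (Submodule.le_topologicalClosure _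
          (Submodule.subset_span ⟨i, ?_⟩))
        simp [hf]
      · have : b.repr (S.symm x) (Sum.inr j) = 0 := by
          rw [b.repr_apply_apply, ← hΦ, hx']; rfl
        simp [this]
  unfold HasDeficiency
  rw [hker]
  have e := (Φ : H →ₗ[ℂ] (Fin k → ℂ)).quotKerEquivOfSurjective hsurj
  have h := e.lift_rank_eq
  rw [rank_fin_fun, Cardinal.lift_natCast] at h
  exact Cardinal.lift_eq_nat_iff.mp h

end RieszAbstract

/-! ### Operators and exponentials in `L²(0, T; ℂ)` -/

/-- The operator of multiplication by a bounded continuous function on `L²(0, T; ℂ)`. -/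
theorem exists_mul_operator {T : ℝ} (φ : ℝ → ℂ) (hφ : Continuous φ) {C : ℝ} (hC : 0 ≤ C)
    (hb : ∀ t ∈ Set.Ioo (0 : ℝ) T, ‖φ t‖ ≤ C) :
    ∃ M : L2 T →L[ℂ] L2 T,
      (∀ f : L2 T, M f =ᵐ[volume.restrict (Set.Ioo (0 : ℝ) T)] fun t => φ t * f t) ∧ ‖M‖ ≤ C := by
  have hb' : ∀ f : L2 T, ∀ᵐ t ∂(volume.restrict (Set.Ioo (0 : ℝ) T)),
      ‖φ t * f t‖ ≤ C * ‖f t‖ := fun f => by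
    filter_upwards [ae_restrict_mem measurableSet_Ioo] with t ht
    rw [norm_mul]
    exact mul_le_mul_of_nonneg_right (hb t ht) (norm_nonneg _)
  have hm : ∀ f : L2 T, MemLp (fun t => φ t * f t) 2 (volume.restrict (Set.Ioo (0 : ℝ) T)) :=
    fun f => MemLp.of_le_mul (Lp.memLp f)
      (hφ.aestronglyMeasurable.mul (Lp.aestronglyMeasurable f)) (hb' f)
  let L : L2 T →ₗ[ℂ] L2 T :=
    { toFun := fun f => (hm f).toLp _
      map_add' := fun f g => by
        rw [← MemLp.toLp_add, MemLp.toLp_eq_toLp_iff]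
        filter_upwards [Lp.coeFn_add f g] with t ht
        simp only [ht, Pi.add_apply, mul_add]
      map_smul' := fun c f => by
        rw [RingHom.id_apply, ← MemLp.toLp_const_smul, MemLp.toLp_eq_toLp_iff]
        filter_upwards [Lp.coeFn_smul c f] with t ht
        simp only [ht, Pi.smul_apply, smul_eq_mul]
        ring }
  refine ⟨L.mkContinuous C fun f => ?_, fun f => (hm f).coeFn_toLp,
    LinearMap.mkContinuous_norm_le _ hC _⟩
  refine Lp.norm_le_mul_norm_of_ae_le_mul ?_
  filter_upwards [(hm f).coeFn_toLp, hb' f] with t h1 h2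
  change ‖(hm f).toLp _ t‖ ≤ _
  rw [h1]
  exact h2

theorem coeFn_expL2 (T w : ℝ) : expL2 T w =ᵐ[volume.restrict (Set.Ioo (0 : ℝ) T)]
    fun t : ℝ => Complex.exp (Complex.I * ((w * t : ℝ) : ℂ)) :=
  (memLp_exp T w).coeFn_toLp

/-- Exponentials depend on their frequency in a Lipschitz way. -/
theorem exists_norm_expL2_sub_le (T : ℝ) :
    ∃ K : ℝ, 0 ≤ K ∧ ∀ a b : ℝ, ‖expL2 T a - expL2 T b‖ ≤ K * |a - b| := by
  refine ⟨(measureUnivNNReal (volume.restrict (Set.Ioo (0 : ℝ) T)) : ℝ) ^ (2 : ℝ≥0∞).toReal⁻¹ *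
    |T|, by positivity, fun a b => ?_⟩
  rw [mul_assoc]
  refine Lp.norm_le_of_ae_bound (by positivity) ?_
  filter_upwards [Lp.coeFn_sub (expL2 T a) (expL2 T b), coeFn_expL2 T a, coeFn_expL2 T b,
    ae_restrict_mem measurableSet_Ioo] with t h1 h2 h3 ht
  rw [h1, Pi.sub_apply, h2, h3]
  have h4 : Complex.exp (Complex.I * ((a * t : ℝ) : ℂ)) -
      Complex.exp (Complex.I * ((b * t : ℝ) : ℂ)) = Complex.exp (Complex.I * ((b * t : ℝ) : ℂ)) *
        (Complex.exp (Complex.I * (((a - b) * t : ℝ) : ℂ)) - 1) := by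
    rw [mul_sub, ← Complex.exp_add, mul_one]
    congr 2
    push_cast
    ring
  rw [h4, norm_mul, Complex.norm_exp_I_mul_ofReal, one_mul]
  refine Real.norm_exp_I_mul_ofReal_sub_one_le.trans ?_
  rw [Real.norm_eq_abs, abs_mul, mul_comm]
  have : |t| ≤ |T| := by
    rw [abs_of_pos ht.1]
    exact ht.2.le.trans (le_abs_self T)
  gcongr

theorem continuous_expL2 (T : ℝ) : Continuous (expL2 T) := by
  obtain ⟨K, hK, h⟩ := exists_norm_expL2_sub_le T
  exact (LipschitzWith.of_dist_le_mul (K := ⟨K, hK⟩) fun a b => by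
    rw [dist_eq_norm, Real.dist_eq]; exact h a b).continuous

/-- The Volterra operator: integration from `0`. -/
theorem exists_volterra_operator (T : ℝ) :
    ∃ V : L2 T →L[ℂ] L2 T, ∀ f : L2 T, V f =ᵐ[volume.restrict (Set.Ioo (0 : ℝ) T)]
      fun t => ∫ s in (0 : ℝ)..t, f s ∂(volume.restrict (Set.Ioo (0 : ℝ) T)) := by
  set μ := volume.restrict (Set.Ioo (0 : ℝ) T) with hμ
  have hint : ∀ f : L2 T, Integrable f μ := fun f => (Lp.memLp f).integrable (by norm_num)
  have hcont : ∀ f : L2 T, Continuous fun t => ∫ s in (0 : ℝ)..t, f s ∂μ := fun f =>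
    intervalIntegral.continuous_primitive (fun a b => (hint f).intervalIntegrable) 0
  set K : ℝ := (μ Set.univ ^ (1 / (1 : ℝ≥0∞).toReal - 1 / (2 : ℝ≥0∞).toReal)).toReal with hK
  have hbound : ∀ f : L2 T, ∀ t, ‖∫ s in (0 : ℝ)..t, f s ∂μ‖ ≤ K * ‖f‖ := fun f t => by
    have h1 : ‖∫ s in (0 : ℝ)..t, f s ∂μ‖ ≤ ∫ s, ‖f s‖ ∂μ :=
      (intervalIntegral.norm_integral_le_integral_norm_uIoc).trans
        (setIntegral_le_integral (hint f).norm (Filter.Eventually.of_forall fun _ => norm_nonneg _))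
    refine h1.trans ?_
    rw [integral_norm_eq_lintegral_enorm (hint f).1, ← eLpNorm_one_eq_lintegral_enorm,
      Lp.norm_def, hK, ← ENNReal.toReal_mul, mul_comm]
    refine ENNReal.toReal_mono (ENNReal.mul_ne_top (Lp.eLpNorm_ne_top f) ?_)
      (eLpNorm_le_eLpNorm_mul_rpow_measure_univ (by norm_num) (hint f).1)
    exact ENNReal.rpow_ne_top_of_nonneg (by norm_num) (measure_ne_top _ _)
  have hm : ∀ f : L2 T, MemLp (fun t => ∫ s in (0 : ℝ)..t, f s ∂μ) 2 μ := fun f =>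
    MemLp.of_bound (hcont f).aestronglyMeasurable (K * ‖f‖)
      (Filter.Eventually.of_forall (hbound f))
  let L : L2 T →ₗ[ℂ] L2 T :=
    { toFun := fun f => (hm f).toLp _
      map_add' := fun f g => by
        rw [← MemLp.toLp_add, MemLp.toLp_eq_toLp_iff]
        refine Filter.Eventually.of_forall fun t => ?_
        simp only [Pi.add_apply]
        rw [← intervalIntegral.integral_add (hint f).intervalIntegrable
          (hint g).intervalIntegrable]
        refine intervalIntegral.integral_congr_ae' ?_ ?_ <;>
        filter_upwards [Lp.coeFn_add f g] with s hs _ using hs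
      map_smul' := fun c f => by
        rw [RingHom.id_apply, ← MemLp.toLp_const_smul, MemLp.toLp_eq_toLp_iff]
        refine Filter.Eventually.of_forall fun t => ?_
        simp only [Pi.smul_apply]
        rw [← intervalIntegral.integral_smul]
        refine intervalIntegral.integral_congr_ae' ?_ ?_ <;>
        filter_upwards [Lp.coeFn_smul c f] with s hs _ using hs }
  refine ⟨L.mkContinuous ((measureUnivNNReal μ : ℝ) ^ (2 : ℝ≥0∞).toReal⁻¹ * K) fun f => ?_,
    fun f => (hm f).coeFn_toLp⟩
  rw [mul_assoc]
  refine Lp.norm_le_of_ae_bound (by positivity) ?_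
  filter_upwards [(hm f).coeFn_toLp] with t h1
  change ‖(hm f).toLp _ t‖ ≤ _
  rw [h1]
  exact hbound f t

/-- There is a bounded operator acting on exponentials as the divided difference at the
frequency `a`. On the Fourier side its adjoint divides out a zero at `a`. -/
theorem exists_divided_difference_operator (T a : ℝ) :
    ∃ R : L2 T →L[ℂ] L2 T, ∀ x : ℝ, x ≠ a →
      R (expL2 T x) = (((x - a : ℝ) : ℂ)⁻¹) • (expL2 T x - expL2 T a) := by
  obtain ⟨V, hV⟩ := exists_volterra_operator T
  have hnorm : ∀ w t : ℝ, ‖Complex.exp (Complex.I * ((w * t : ℝ) : ℂ))‖ ≤ 1 := fun w t => by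
    rw [Complex.norm_exp_I_mul_ofReal]
  obtain ⟨M₁, hM₁, -⟩ := exists_mul_operator (T := T)
    (fun t : ℝ => Complex.exp (Complex.I * ((-a * t : ℝ) : ℂ))) (by fun_prop) zero_le_one
    (fun t _ => hnorm _ t)
  obtain ⟨M₂, hM₂, -⟩ := exists_mul_operator (T := T)
    (fun t : ℝ => Complex.exp (Complex.I * ((a * t : ℝ) : ℂ))) (by fun_prop) zero_le_one
    (fun t _ => hnorm _ t)
  refine ⟨Complex.I • (M₂ ∘L V ∘L M₁), fun x hx => ?_⟩
  have hxa : ((x - a : ℝ) : ℂ) ≠ 0 := by exact_mod_cast sub_ne_zero.mpr hx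
  apply Lp.ext
  change ↑↑(Complex.I • M₂ (V (M₁ (expL2 T x)))) =ᵐ[_] _
  filter_upwards [Lp.coeFn_smul Complex.I (M₂ (V (M₁ (expL2 T x)))), hM₂ (V (M₁ (expL2 T x))),
    hV (M₁ (expL2 T x)), Lp.coeFn_smul (((x - a : ℝ) : ℂ)⁻¹) (expL2 T x - expL2 T a),
    Lp.coeFn_sub (expL2 T x) (expL2 T a), coeFn_expL2 T x, coeFn_expL2 T a,
    ae_restrict_mem measurableSet_Ioo] with t h1 h2 h3 h4 h5 h6 h7 ht
  rw [h1, Pi.smul_apply, h2, h3, h4, Pi.smul_apply, h5, Pi.sub_apply, h6, h7]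
  have hI : ∫ s in (0 : ℝ)..t, (M₁ (expL2 T x)) s ∂(volume.restrict (Set.Ioo (0 : ℝ) T)) =
      ∫ s in (0 : ℝ)..t, Complex.exp ((Complex.I * ((x - a : ℝ) : ℂ)) * (s : ℂ)) := by
    have e1 : ∫ s in (0 : ℝ)..t, (M₁ (expL2 T x)) s ∂(volume.restrict (Set.Ioo (0 : ℝ) T)) =
        ∫ s in (0 : ℝ)..t, Complex.exp ((Complex.I * ((x - a : ℝ) : ℂ)) * (s : ℂ))
          ∂(volume.restrict (Set.Ioo (0 : ℝ) T)) := by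
      refine intervalIntegral.integral_congr_ae' ?_ ?_ <;>
      · filter_upwards [hM₁ (expL2 T x), coeFn_expL2 T x] with s hs1 hs2 _
        rw [hs1, hs2, ← Complex.exp_add]
        congr 1
        push_cast
        ring
    rw [e1, intervalIntegral.integral_of_le ht.1.le, intervalIntegral.integral_of_le ht.1.le,
      Measure.restrict_restrict measurableSet_Ioc]
    congr 2
    ext s
    simp only [Set.mem_inter_iff, Set.mem_Ioc, Set.mem_Ioo]
    constructor
    · exact fun h => h.1
    · exact fun h => ⟨h, h.1, h.2.trans_lt ht.2⟩
  rw [hI, integral_exp_mul_complex (mul_ne_zero Complex.I_ne_zero hxa)]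
  simp only [smul_eq_mul]
  have e2 : Complex.exp (Complex.I * ((x * t : ℝ) : ℂ)) =
      Complex.exp (Complex.I * ((a * t : ℝ) : ℂ)) *
        Complex.exp (Complex.I * ((x - a : ℝ) : ℂ) * (t : ℂ)) := by
    rw [← Complex.exp_add]
    congr 1
    push_cast
    ring
  rw [e2]
  have hI0 := Complex.I_ne_zero
  simp only [Complex.ofReal_zero, mul_zero, Complex.exp_zero]
  field_simp

/-- In a Riesz basis of exponentials a frequency may be changed to any value which is not the
frequency of another member. -/
theorem IsRieszBasis.update_frequency {ι : Type*} [DecidableEq ι] {T : ℝ} {lam : ι → ℝ}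
    (h : IsRieszBasis fun j => expL2 T (lam j)) (i : ι) {a : ℝ} (ha : ∀ j, j ≠ i → lam j ≠ a) :
    IsRieszBasis fun j => expL2 T (Function.update lam i a j) := by
  obtain ⟨b, S, hS⟩ := h
  by_cases hai : a = lam i
  · subst hai
    exact ⟨b, S, fun j => by rw [Function.update_eq_self]; exact hS j⟩
  have hfun : (fun j => expL2 T (Function.update lam i a j)) =
      Function.update (fun j => S (b j)) i (expL2 T a) := by
    ext1 j
    by_cases hj : j = i
    · subst hj; simp
    · simp [hj, hS]
  rw [hfun]
  refine isRieszBasis_update b S i _ fun h0 => ?_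
  obtain ⟨R, hR⟩ := exists_divided_difference_operator T a
  -- the coefficient functional of the `i`-th member
  set g : L2 T →L[ℂ] ℂ := (innerSL ℂ (b i)).comp (S.symm : L2 T →L[ℂ] L2 T) with hg
  have hgj : ∀ j, g (expL2 T (lam j)) = if i = j then 1 else 0 := fun j => by
    have hj : expL2 T (lam j) = S (b j) := hS j
    rw [hj]
    simp only [hg, ContinuousLinearMap.comp_apply, ContinuousLinearEquiv.coe_coe,
      ContinuousLinearEquiv.symm_apply_apply, innerSL_apply_apply]
    exact orthonormal_iff_ite.mp b.orthonormal i j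
  have hga : g (expL2 T a) = 0 := h0
  have hRx : ∀ x, x ≠ a → g (R (expL2 T x)) = ((x - a : ℝ) : ℂ)⁻¹ * g (expL2 T x) := fun x hx => by
    rw [hR x hx, map_smul, map_sub, hga, sub_zero, smul_eq_mul]
  have hne : ((lam i - a : ℝ) : ℂ) ≠ 0 := by exact_mod_cast sub_ne_zero.mpr (Ne.symm hai)
  -- this functional vanishes on the whole basis
  set l : L2 T →L[ℂ] ℂ := g - ((lam i - a : ℝ) : ℂ) • g.comp R with hl
  have hlx : ∀ x, x ≠ a → l (expL2 T x) =
      g (expL2 T x) - ((lam i - a : ℝ) : ℂ) * (((x - a : ℝ) : ℂ)⁻¹ * g (expL2 T x)) :=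
    fun x hx => by
    rw [← hRx x hx]
    simp [hl]
  have hl0 : l = 0 := by
    have h1 : l.comp (S : L2 T →L[ℂ] L2 T) = 0 := by
      refine ContinuousLinearMap.ext_on (s := Set.range b) ?_ ?_
      · rw [Submodule.dense_iff_topologicalClosure_eq_top, b.dense_span]
      · rintro _ ⟨j, rfl⟩
        have hj : S (b j) = expL2 T (lam j) := (hS j).symm
        rw [ContinuousLinearMap.comp_apply, ContinuousLinearEquiv.coe_coe, hj]
        by_cases hij : j = i
        · subst hij
          rw [hlx _ (Ne.symm hai), hgj]
          rw [if_pos rfl, mul_one, mul_inv_cancel₀ hne, sub_self,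
            zero_apply]
        · rw [hlx _ (ha j hij), hgj]
          simp [Ne.symm hij]
    ext x
    have := congrArg (fun m : L2 T →L[ℂ] ℂ => m (S.symm x)) h1
    simpa using this
  have hx0 : ∀ x, x ≠ a → x ≠ lam i → g (expL2 T x) = 0 := fun x hx hxi => by
    have hxa : ((x - a : ℝ) : ℂ) ≠ 0 := by exact_mod_cast sub_ne_zero.mpr hx
    have hxl : ((x : ℝ) : ℂ) - (lam i : ℝ) ≠ 0 := by exact_mod_cast sub_ne_zero.mpr hxi
    have h2 := hlx x hx
    rw [hl0, zero_apply] at h2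
    have h3 : (((x : ℝ) : ℂ) - (lam i : ℝ)) * g (expL2 T x) = 0 := by
      have : ((x - a : ℝ) : ℂ) * (g (expL2 T x) -
          ((lam i - a : ℝ) : ℂ) * (((x - a : ℝ) : ℂ)⁻¹ * g (expL2 T x))) = 0 := by
        rw [← h2, mul_zero]
      rw [← this]
      field_simp
      push_cast
      ring
    exact (mul_eq_zero.mp h3).resolve_left hxl
  -- by continuity the functional vanishes at the frequency `lam i` too, where it should be `1`
  have hdense : Dense {x : ℝ | x ≠ a ∧ x ≠ lam i} := by
    have : {x : ℝ | x ≠ a ∧ x ≠ lam i} = ({a, lam i} : Set ℝ)ᶜ := by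
      ext x; simp
    rw [this]
    exact ((Set.toFinite ({a, lam i} : Set ℝ)).countable).dense_compl ℝ
  have hcont : Continuous fun x => g (expL2 T x) := g.continuous.comp (continuous_expL2 T)
  have hall := hcont.ext_on hdense continuous_const (fun x hx => hx0 x hx.1 hx.2)
  have h1 := hgj i
  have h2 := congrFun hall (lam i)
  rw [h2] at h1
  simp at h1

/-! ### Replacement of finitely many frequencies -/

/-- Replacement of finitely many frequencies by new ones, none of which occurs among the old. -/
theorem IsRieszBasis.replace_frequencies_of_disjoint {ι : Type*} {T : ℝ} {lam lam' : ι → ℝ}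
    (h : IsRieszBasis fun j => expL2 T (lam j)) (F : Finset ι)
    (hF : ∀ j ∉ F, lam' j = lam j) (hinj : Set.InjOn lam' F)
    (hdisj : ∀ i ∈ F, ∀ j, lam' i ≠ lam j) : IsRieszBasis fun j => expL2 T (lam' j) := by
  classical
  induction F using Finset.induction_on generalizing lam' with
  | empty =>
    have : lam' = lam := funext fun j => hF j (by simp)
    rwa [this]
  | insert i F hi ih =>
    have h1 := ih (lam' := Function.update lam' i (lam i))
      (fun j hj => by
        by_cases hji : j = i
        · subst hji; simp
        · simp [hji, hF j (by simp [hji, hj])])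
      (fun x hx y hy hxy => by
        have hxi : x ≠ i := fun e => hi (e ▸ hx)
        have hyi : y ≠ i := fun e => hi (e ▸ hy)
        simp only [Function.update_of_ne hxi, Function.update_of_ne hyi] at hxy
        exact hinj (by simp [Finset.mem_coe.mp hx]) (by simp [Finset.mem_coe.mp hy]) hxy)
      (fun x hx j => by
        have hxi : x ≠ i := fun e => hi (e ▸ hx)
        rw [Function.update_of_ne hxi]
        exact hdisj x (by simp [hx]) j)
    have h2 := h1.update_frequency i (a := lam' i) (fun j hj => by
      rw [Function.update_of_ne hj]
      by_cases hjF : j ∈ F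
      · intro e
        exact hj (hinj (by simp [hjF]) (by simp) e)
      · rw [hF j (by simp [hj, hjF])]
        exact (hdisj i (by simp) j).symm)
    simpa using h2

theorem infinite_compl_of_countable {s : Set ℝ} (hs : s.Countable) : sᶜ.Infinite := fun hfin =>
  Set.not_countable_univ (α := ℝ) (by
    rw [← Set.union_compl_self s]
    exact hs.union hfin.countable)

/-- Finitely many frequencies of a Riesz basis of exponentials may be replaced, provided the new
frequencies are pairwise distinct and differ from the ones that are kept. -/
theorem IsRieszBasis.replace_frequencies {ι : Type*} [Countable ι] {T : ℝ} {lam lam' : ι → ℝ}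
    (h : IsRieszBasis fun j => expL2 T (lam j)) (F : Finset ι)
    (hF : ∀ j ∉ F, lam' j = lam j) (hinj : Function.Injective lam') :
    IsRieszBasis fun j => expL2 T (lam' j) := by
  classical
  -- pass through frequencies `y` that occur neither among the old nor among the new ones
  have hinf : ((Set.range lam ∪ Set.range lam')ᶜ).Infinite :=
    infinite_compl_of_countable ((Set.countable_range lam).union (Set.countable_range lam'))
  have := hinf.to_subtype
  let _ := Encodable.ofCountable ι
  let y : ι → ℝ := fun i =>
    (Infinite.natEmbedding ↥(Set.range lam ∪ Set.range lam')ᶜ (Encodable.encode i) : ℝ)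
  have hy : ∀ i, y i ∉ Set.range lam ∪ Set.range lam' := fun i =>
    (Infinite.natEmbedding ↥(Set.range lam ∪ Set.range lam')ᶜ (Encodable.encode i)).2
  have hyinj : Function.Injective y := fun i j hij =>
    Encodable.encode_injective ((Infinite.natEmbedding _).injective (Subtype.ext hij))
  let m : ι → ℝ := fun i => if i ∈ F then y i else lam i
  have h1 : IsRieszBasis fun j => expL2 T (m j) := by
    refine h.replace_frequencies_of_disjoint F (fun j hj => by simp [m, hj]) ?_ ?_
    · intro i hi j hj hij
      simp only [m, Finset.mem_coe.mp hi, Finset.mem_coe.mp hj, if_true] at hij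
      exact hyinj hij
    · intro i hi j hij
      simp only [m, hi, if_true] at hij
      exact hy i (Or.inl ⟨j, hij.symm⟩)
  refine h1.replace_frequencies_of_disjoint F (fun j hj => by simp [m, hj, hF]) hinj.injOn ?_
  intro i hi j hij
  by_cases hj : j ∈ F
  · simp only [m, hj, if_true] at hij
    exact hy j (Or.inr ⟨i, hij⟩)
  · simp only [m, hj, if_false] at hij
    rw [← hF j hj] at hij
    exact hj (hinj hij ▸ hi)

/-! ### Orthonormal exponentials -/

theorem inner_expL2_eq_integral {T : ℝ} (a : ℝ) (f : L2 T) :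
    ⟪expL2 T a, f⟫_ℂ =
      ∫ t in Set.Ioo (0 : ℝ) T, Complex.exp (Complex.I * ((-a * t : ℝ) : ℂ)) * f t := by
  rw [L2.inner_def]
  refine integral_congr_ae ?_
  filter_upwards [coeFn_expL2 T a] with t ht
  rw [ht]
  simp only [RCLike.inner_apply, ← Complex.exp_conj, map_mul, Complex.conj_I, Complex.conj_ofReal]
  rw [mul_comm]
  congr 2
  push_cast
  ring

theorem inner_expL2_self {T : ℝ} (hT : 0 < T) (a : ℝ) : ⟪expL2 T a, expL2 T a⟫_ℂ = T := by
  rw [inner_expL2_eq_integral]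
  have : ∫ t in Set.Ioo (0 : ℝ) T, Complex.exp (Complex.I * ((-a * t : ℝ) : ℂ)) * expL2 T a t =
      ∫ t in Set.Ioo (0 : ℝ) T, (1 : ℂ) := by
    refine integral_congr_ae ?_
    filter_upwards [coeFn_expL2 T a] with t ht
    rw [ht, ← Complex.exp_add, ← mul_add, ← Complex.ofReal_add]
    simp
  rw [this]
  simp [hT.le]

theorem inner_expL2_of_int {T : ℝ} (hT : 0 < T) {a b : ℝ} {n : ℤ} (hn : n ≠ 0)
    (hab : (b - a) * T = 2 * Real.pi * n) : ⟪expL2 T a, expL2 T b⟫_ℂ = 0 := by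
  rw [inner_expL2_eq_integral]
  have h1 : ∫ t in Set.Ioo (0 : ℝ) T, Complex.exp (Complex.I * ((-a * t : ℝ) : ℂ)) * expL2 T b t =
      ∫ t in Set.Ioo (0 : ℝ) T, Complex.exp ((Complex.I * ((b - a : ℝ) : ℂ)) * (t : ℂ)) := by
    refine integral_congr_ae ?_
    filter_upwards [coeFn_expL2 T b] with t ht
    rw [ht, ← Complex.exp_add]
    congr 1
    push_cast
    ring
  have hba : ((b - a : ℝ) : ℂ) ≠ 0 := by
    have : b - a ≠ 0 := by
      intro h0
      rw [h0, zero_mul] at hab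
      have : (n : ℝ) ≠ 0 := by exact_mod_cast hn
      have := Real.pi_pos.ne'
      simp_all
    exact_mod_cast this
  rw [h1, ← integral_Ioc_eq_integral_Ioo, ← intervalIntegral.integral_of_le hT.le,
    integral_exp_mul_complex (mul_ne_zero Complex.I_ne_zero hba)]
  have h2 : Complex.I * ((b - a : ℝ) : ℂ) * (T : ℂ) = n * (2 * Real.pi * Complex.I) := by
    rw [mul_assoc, ← Complex.ofReal_mul, hab]
    push_cast
    ring
  rw [h2, Complex.exp_int_mul_two_pi_mul_I]
  simp

/-- The exponentials with frequencies in `(2π/T) ℤ` are total. -/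
theorem eq_zero_of_inner_expL2_eq_zero {T : ℝ} (hT : 0 < T) {f : L2 T}
    (hf0 : ∀ n : ℤ, ⟪expL2 T (2 * Real.pi / T * n), f⟫_ℂ = 0) : f = 0 := by
  have hmem : MemLp f 2 (volume.restrict (Set.Ioc 0 T)) := by
    rw [← restrict_Ioo_eq_restrict_Ioc]
    exact Lp.memLp f
  have hp := hasSum_sq_fourierCoeffOn hT hmem
  have hc : ∀ n : ℤ, fourierCoeffOn hT f n = 0 := fun n => by
    rw [fourierCoeffOn_eq_integral, intervalIntegral.integral_of_le hT.le,
      integral_Ioc_eq_integral_Ioo]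
    have h1 := hf0 n
    rw [inner_expL2_eq_integral] at h1
    rw [smul_eq_zero]
    right
    rw [← h1]
    refine integral_congr_ae (Filter.Eventually.of_forall fun t => ?_)
    simp only [smul_eq_mul]
    congr 1
    rw [fourier_coe_apply]
    congr 1
    push_cast
    rw [sub_zero]
    ring
  have h0 : (T - 0)⁻¹ • ∫ x in (0 : ℝ)..T, ‖f x‖ ^ 2 = 0 := by
    refine hp.unique ?_
    simp only [hc]
    simp
  have h2 : ∫ x in Set.Ioo (0 : ℝ) T, ‖f x‖ ^ 2 = 0 := by
    rw [← integral_Ioc_eq_integral_Ioo, ← intervalIntegral.integral_of_le hT.le]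
    rcases smul_eq_zero.mp h0 with h | h
    · simp [hT.ne'] at h
    · exact h
  rw [integral_eq_zero_iff_of_nonneg (fun _ => sq_nonneg _)
    ((memLp_two_iff_integrable_sq_norm (Lp.aestronglyMeasurable f)).mp (Lp.memLp f))] at h2
  apply Lp.ext
  filter_upwards [h2, Lp.coeFn_zero ℂ 2 (volume.restrict (Set.Ioo (0 : ℝ) T))] with t ht h0t
  rw [h0t]
  simpa using ht

/-- The normalised exponentials with frequencies in `(2π/T) (ℤ + c)` form a Hilbert basis. -/
theorem exists_hilbertBasis_exp {T : ℝ} (hT : 0 < T) (c : ℝ) :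
    ∃ b : HilbertBasis ℤ ℂ (L2 T), ∀ n : ℤ,
      b n = ((√T : ℝ) : ℂ)⁻¹ • expL2 T (2 * Real.pi / T * (n + c)) := by
  have hs : ((√T : ℝ) : ℂ) ≠ 0 := by exact_mod_cast (Real.sqrt_pos.mpr hT).ne'
  have ho : Orthonormal ℂ fun n : ℤ =>
      ((√T : ℝ) : ℂ)⁻¹ • expL2 T (2 * Real.pi / T * (n + c)) := by
    rw [orthonormal_iff_ite]
    intro i j
    rw [inner_smul_left, inner_smul_right]
    split_ifs with hij
    · subst hij
      rw [inner_expL2_self hT, map_inv₀, Complex.conj_ofReal]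
      have : (T : ℂ) = ((√T : ℝ) : ℂ) * ((√T : ℝ) : ℂ) := by
        rw [← Complex.ofReal_mul, Real.mul_self_sqrt hT.le]
      rw [this]
      field_simp
    · rw [inner_expL2_of_int hT (n := j - i) (sub_ne_zero.mpr (Ne.symm hij)) ?_]
      · simp
      · push_cast
        field_simp
        ring
  refine ⟨HilbertBasis.mkOfOrthogonalEqBot ho ?_, fun n => by
    rw [HilbertBasis.coe_mkOfOrthogonalEqBot]⟩
  rw [Submodule.eq_bot_iff]
  intro f hf
  obtain ⟨M, hM, -⟩ := exists_mul_operator (T := T)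
    (fun t : ℝ => Complex.exp (Complex.I * ((-(2 * Real.pi / T * c) * t : ℝ) : ℂ)))
    (by fun_prop) zero_le_one (fun t _ => by rw [Complex.norm_exp_I_mul_ofReal])
  have hMf : M f = 0 := by
    refine eq_zero_of_inner_expL2_eq_zero hT fun n => ?_
    have h1 := Submodule.inner_right_of_mem_orthogonal
      (Submodule.subset_span (Set.mem_range_self n)) hf
    rw [inner_smul_left] at h1
    have h2 : ⟪expL2 T (2 * Real.pi / T * (n + c)), f⟫_ℂ = 0 := by simpa [hs] using h1
    rw [← h2, inner_expL2_eq_integral, inner_expL2_eq_integral]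
    refine integral_congr_ae ?_
    filter_upwards [hM f] with t ht
    rw [ht, ← mul_assoc, ← Complex.exp_add]
    congr 2
    push_cast
    ring
  apply Lp.ext
  have h3 := hM f
  rw [hMf] at h3
  filter_upwards [h3, Lp.coeFn_zero ℂ 2 (volume.restrict (Set.Ioo (0 : ℝ) T))] with t ht h0t
  rw [h0t] at ht ⊢
  exact ((mul_eq_zero.mp ht.symm).resolve_left (Complex.exp_ne_zero _))

/-! ### Kadec's theorem for a step sequence -/

theorem one_sub_cos_add_sin_lt_one {x : ℝ} (h0 : 0 ≤ x) (hx : x < Real.pi / 4) :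
    1 - Real.cos x + Real.sin x < 1 := by
  have h : Real.cos (Real.pi / 2 - x) < Real.cos x :=
    Real.cos_lt_cos_of_nonneg_of_le_pi h0 (by linarith) (by linarith)
  rw [Real.cos_pi_div_two_sub] at h
  linarith

/-- Kadec's estimate for the frequencies `n + c ± δ`, in units of `2π/T` and with the sign of `±`
constant on `n ≥ 0` and on `n < 0`. With `θ = 2π/T (t - T/2) ∈ (-π, π)` the operator is
`cos (δθ) + i sin (δθ) P`, where `P` is diagonal with entries `±1`. -/
theorem exists_operator_shifted_exp {T : ℝ} (hT : 0 < T) (c : ℝ) {δ : ℝ} (hδ : |δ| < 1 / 4) :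
    ∃ (b : HilbertBasis ℤ ℂ (L2 T)) (A : L2 T →L[ℂ] L2 T) (u : ℤ → ℂ), ‖A - 1‖ < 1 ∧
      (∀ n, ‖u n‖ = 1) ∧ ∀ n : ℤ, A (b n) = (u n * ((√T : ℝ) : ℂ)⁻¹) •
        expL2 T (2 * Real.pi / T * (n + c + if 0 ≤ n then δ else -δ)) := by
  obtain ⟨b, hb⟩ := exists_hilbertBasis_exp hT c
  have hpi := Real.pi_pos
  let s : ℤ → ℝ := fun n => if 0 ≤ n then 1 else -1
  have hs : ∀ n, s n = 1 ∨ s n = -1 := fun n => by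
    by_cases h : 0 ≤ n
    · left; simp [s, h]
    · right; simp [s, h]
  obtain ⟨b', hb'⟩ := exists_hilbertBasis_unit_smul b (c := fun n => ((s n : ℝ) : ℂ))
    (fun n => by rcases hs n with h | h <;> simp [h])
  let P : L2 T →L[ℂ] L2 T :=
    (b.repr.trans b'.repr.symm).toLinearIsometry.toContinuousLinearMap
  have hPn : ‖P‖ ≤ 1 := LinearIsometry.norm_toContinuousLinearMap_le _
  have hP : ∀ n, P (b n) = ((s n : ℝ) : ℂ) • b n := fun n => by
    classical
    rw [← hb' n]
    change b'.repr.symm (b.repr (b n)) = b' n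
    rw [b.repr_self, b'.repr_symm_single]
  let θ : ℝ → ℝ := fun t => δ * (2 * Real.pi / T * (t - T / 2))
  have hθc : Continuous θ := by fun_prop
  set x := Real.pi * |δ| with hx
  have hx0 : 0 ≤ x := by positivity
  have hx4 : x < Real.pi / 4 := by rw [hx]; nlinarith
  have hθ : ∀ t ∈ Set.Ioo 0 T, |θ t| ≤ x := fun t ht => by
    have h1 : |2 * Real.pi / T * (t - T / 2)| ≤ Real.pi := by
      rw [abs_mul, abs_of_pos (by positivity)]
      have h2 : |t - T / 2| ≤ T / 2 := abs_le.mpr ⟨by linarith [ht.1], by linarith [ht.2]⟩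
      calc 2 * Real.pi / T * |t - T / 2| ≤ 2 * Real.pi / T * (T / 2) := by gcongr
        _ = Real.pi := by field_simp
    simp only [θ]
    rw [abs_mul, hx, mul_comm]
    gcongr
  obtain ⟨N₁, hN₁, hN₁n⟩ := exists_mul_operator (T := T) (C := 1 - Real.cos x)
    (fun t => ((Real.cos (θ t) - 1 : ℝ) : ℂ)) (by fun_prop)
    (sub_nonneg.mpr (Real.cos_le_one _)) (fun t ht => by
      rw [Complex.norm_real, Real.norm_eq_abs, abs_sub_comm,
        abs_of_nonneg (sub_nonneg.mpr (Real.cos_le_one _)), ← Real.cos_abs (θ t)]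
      have := Real.cos_le_cos_of_nonneg_of_le_pi (abs_nonneg (θ t)) (by linarith) (hθ t ht)
      linarith)
  obtain ⟨N₂, hN₂, hN₂n⟩ := exists_mul_operator (T := T) (C := Real.sin x)
    (fun t => ((Real.sin (θ t) : ℝ) : ℂ)) (by fun_prop)
    (Real.sin_nonneg_of_nonneg_of_le_pi hx0 (by linarith)) (fun t ht => by
      have h1 := abs_le.mp (hθ t ht)
      rw [Complex.norm_real, Real.norm_eq_abs, abs_le, ← Real.sin_neg]
      constructor <;> apply Real.sin_le_sin_of_le_of_le_pi_div_two <;> linarith)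
  refine ⟨b, 1 + N₁ + Complex.I • N₂ ∘L P,
    fun n => Complex.exp (Complex.I * ((-(s n * δ * Real.pi) : ℝ) : ℂ)), ?_,
    fun n => Complex.norm_exp_I_mul_ofReal _, fun n => ?_⟩
  · calc ‖1 + N₁ + Complex.I • N₂ ∘L P - 1‖ = ‖N₁ + Complex.I • N₂ ∘L P‖ := by
          congr 1; abel
      _ ≤ ‖N₁‖ + ‖Complex.I • N₂ ∘L P‖ := norm_add_le _ _
      _ ≤ (1 - Real.cos x) + Real.sin x := by
          gcongr
          rw [norm_smul, Complex.norm_I, one_mul]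
          calc ‖N₂ ∘L P‖ ≤ ‖N₂‖ * ‖P‖ := ContinuousLinearMap.opNorm_comp_le _ _
            _ ≤ ‖N₂‖ * 1 := by gcongr
            _ ≤ Real.sin x := by rw [mul_one]; exact hN₂n
      _ < 1 := one_sub_cos_add_sin_lt_one hx0 hx4
  · have hA : (1 + N₁ + Complex.I • N₂ ∘L P) (b n) =
        b n + N₁ (b n) + (Complex.I * ((s n : ℝ) : ℂ)) • N₂ (b n) := by
      change b n + N₁ (b n) + Complex.I • N₂ (P (b n)) = _
      rw [hP, map_smul, smul_smul]
    rw [hA]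
    apply Lp.ext
    have hbn := Lp.coeFn_smul ((√T : ℝ) : ℂ)⁻¹ (expL2 T (2 * Real.pi / T * (n + c)))
    rw [← hb n] at hbn
    filter_upwards [Lp.coeFn_add (b n + N₁ (b n)) ((Complex.I * ((s n : ℝ) : ℂ)) • N₂ (b n)),
      Lp.coeFn_add (b n) (N₁ (b n)), Lp.coeFn_smul (Complex.I * ((s n : ℝ) : ℂ)) (N₂ (b n)),
      hN₁ (b n), hN₂ (b n), hbn, coeFn_expL2 T (2 * Real.pi / T * (n + c)),
      Lp.coeFn_smul (Complex.exp (Complex.I * ((-(s n * δ * Real.pi) : ℝ) : ℂ)) *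
        ((√T : ℝ) : ℂ)⁻¹) (expL2 T (2 * Real.pi / T * (n + c + if 0 ≤ n then δ else -δ))),
      coeFn_expL2 T (2 * Real.pi / T * (n + c + if 0 ≤ n then δ else -δ))]
      with t h1 h2 h3 h4 h5 h6 h7 h8 h9
    rw [h1, Pi.add_apply, h2, Pi.add_apply, h3, Pi.smul_apply, h4, h5, h6, Pi.smul_apply, h7, h8,
      Pi.smul_apply, h9]
    simp only [smul_eq_mul]
    have hsδ : (if 0 ≤ n then δ else -δ) = s n * δ := by
      by_cases h : 0 ≤ n <;> simp [s, h]
    have hexp : Complex.exp (Complex.I * ((-(s n * δ * Real.pi) : ℝ) : ℂ)) *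
        Complex.exp (Complex.I * ((2 * Real.pi / T * (n + c + s n * δ) * t : ℝ) : ℂ)) =
        Complex.exp (Complex.I * ((2 * Real.pi / T * (n + c) * t : ℝ) : ℂ)) *
          Complex.exp (((s n * θ t : ℝ) : ℂ) * Complex.I) := by
      rw [← Complex.exp_add, ← Complex.exp_add]
      congr 1
      rw [mul_comm ((s n * θ t : ℝ) : ℂ), ← mul_add, ← mul_add, ← Complex.ofReal_add,
        ← Complex.ofReal_add]
      congr 2
      simp only [θ]
      field_simp
      ring
    have hcs : Complex.exp (((s n * θ t : ℝ) : ℂ) * Complex.I) =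
        1 + ((Real.cos (θ t) - 1 : ℝ) : ℂ) +
          Complex.I * ((s n : ℝ) : ℂ) * ((Real.sin (θ t) : ℝ) : ℂ) := by
      rw [Complex.exp_mul_I, ← Complex.ofReal_cos, ← Complex.ofReal_sin]
      rcases hs n with h | h <;>
      · simp only [h, one_mul, neg_mul, Real.cos_neg, Real.sin_neg]
        push_cast
        ring
    rw [hsδ, mul_right_comm (Complex.exp _) ((√T : ℝ) : ℂ)⁻¹, hexp, hcs]
    ring

/-- Kadec's theorem in the form needed here: distinct real frequencies which approach, in `ℓ²`, the
frequencies `n + c ± δ` with `|δ| < 1/4` (in units of `2π/T`) give a Riesz basis. -/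
theorem isRieszBasis_expL2_of_summable {T : ℝ} (hT : 0 < T) (c : ℝ) {δ : ℝ} (hδ : |δ| < 1 / 4)
    {σ : ℤ → ℝ} (hinj : Function.Injective σ)
    (hσ : Summable fun n : ℤ =>
      (σ n - 2 * Real.pi / T * (n + c + if 0 ≤ n then δ else -δ)) ^ 2) :
    IsRieszBasis fun n => expL2 T (σ n) := by
  classical
  obtain ⟨b, A, u, hA, hu, hAb⟩ := exists_operator_shifted_exp hT c hδ
  obtain ⟨K, hK, hlip⟩ := exists_norm_expL2_sub_le T
  have hs : ((√T : ℝ) : ℂ) ≠ 0 := by exact_mod_cast (Real.sqrt_pos.mpr hT).ne'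
  set lam : ℤ → ℝ := fun n => 2 * Real.pi / T * (n + c + if 0 ≤ n then δ else -δ) with hlam
  obtain ⟨F, hF⟩ := exists_isRieszBasis_of_tail b A hA
    (f := fun n => (u n * ((√T : ℝ) : ℂ)⁻¹) • expL2 T (σ n)) (by
      refine Summable.of_nonneg_of_le (fun _ => sq_nonneg _) (fun n => ?_)
        (hσ.mul_left ((√T)⁻¹ * K) |>.mul_left ((√T)⁻¹ * K))
      rw [hAb, ← smul_sub, norm_smul, norm_mul, hu, one_mul, norm_inv, Complex.norm_real,
        Real.norm_of_nonneg (Real.sqrt_nonneg T)]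
      calc ((√T)⁻¹ * ‖expL2 T (σ n) - expL2 T (lam n)‖) ^ 2
          ≤ ((√T)⁻¹ * (K * |σ n - lam n|)) ^ 2 := by
            gcongr
            exact hlip _ _
        _ = (√T)⁻¹ * K * ((√T)⁻¹ * K * (σ n - lam n) ^ 2) := by
            rw [mul_pow, mul_pow, sq_abs]; ring)
  let m : ℤ → ℝ := fun n => if n ∈ F then lam n else σ n
  have h1 : IsRieszBasis fun n => (u n * ((√T : ℝ) : ℂ)⁻¹) • expL2 T (m n) :=
    hF _ (fun n hn => by simp only [m, hn, if_true]; rw [hAb])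
      (fun n hn => by simp only [m, hn, if_false])
  have h2 : IsRieszBasis fun n => expL2 T (m n) := by
    have hu0 : ∀ n, u n ≠ 0 := fun n h => by simpa [h] using hu n
    convert! (h1.unit_smul (c := fun n => (u n)⁻¹) (fun n => by simp [hu])).const_smul hs
      using 2 with n
    rw [smul_smul, smul_smul]
    have : ((√T : ℝ) : ℂ) * (u n)⁻¹ * (u n * ((√T : ℝ) : ℂ)⁻¹) = 1 := by
      have := hu0 n
      field_simp
    rw [this, one_smul]
  exact h2.replace_frequencies F (fun n hn => by simp [m, hn]) hinj

end Exponentials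

section BesselZeros

open Filter Topology

/-! ### The power series of the Bessel function -/

/-- The coefficients of the power series of `J_ν`. -/
def besselCoeff (ν : ℝ) (m : ℕ) : ℝ :=
  (-1 : ℝ) ^ m / ((m.factorial : ℝ) * Real.Gamma ((m : ℝ) + ν + 1))

/-- The entire function `Φ_ν` with `J_ν(y) = (y/2)^ν Φ_ν((y/2)²)`. -/
def besselPhi (ν w : ℝ) : ℝ := ∑' m : ℕ, besselCoeff ν m * w ^ m

theorem besselCoeff_zero_ne_zero {ν : ℝ} (hν : -1 < ν) : besselCoeff ν 0 ≠ 0 := by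
  have : 0 < Real.Gamma (ν + 1) := Real.Gamma_pos_of_pos (by linarith)
  simp [besselCoeff, this.ne']

theorem besselCoeff_succ_mul (ν : ℝ) (m : ℕ) :
    besselCoeff ν (m + 1) * ((m + 1 : ℕ) : ℝ) = -besselCoeff (ν + 1) m := by
  have h : (((m + 1 : ℕ) : ℝ) + ν + 1) = (m : ℝ) + (ν + 1) + 1 := by push_cast; ring
  unfold besselCoeff
  rw [h, Nat.factorial_succ, pow_succ]
  have : ((m + 1 : ℕ) : ℝ) ≠ 0 := by positivity
  push_cast at this ⊢
  field_simp

theorem exists_abs_besselCoeff_le {ν : ℝ} (hν : -1 < ν) :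
    ∃ K : ℝ, ∀ m, |besselCoeff ν m| ≤ K * (1 / (m.factorial : ℝ)) := by
  have hG : ∀ m : ℕ, 0 < Real.Gamma ((m : ℝ) + ν + 1) := fun m =>
    Real.Gamma_pos_of_pos (by have : (0 : ℝ) ≤ m := m.cast_nonneg; linarith)
  have hstep : ∀ m : ℕ, 1 ≤ m → (Real.Gamma (((m + 1 : ℕ) : ℝ) + ν + 1))⁻¹ ≤
      (Real.Gamma ((m : ℝ) + ν + 1))⁻¹ := fun m hm => by
    have hm' : (1 : ℝ) ≤ m := by exact_mod_cast hm
    have e : ((m + 1 : ℕ) : ℝ) + ν + 1 = ((m : ℝ) + ν + 1) + 1 := by push_cast; ring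
    rw [e, Real.Gamma_add_one (by linarith)]
    exact inv_anti₀ (hG m) (le_mul_of_one_le_left (hG m).le (by linarith))
  refine ⟨max (Real.Gamma ((0 : ℕ) + ν + 1))⁻¹ (Real.Gamma ((1 : ℕ) + ν + 1))⁻¹, fun m => ?_⟩
  have hK : (Real.Gamma ((m : ℝ) + ν + 1))⁻¹ ≤
      max (Real.Gamma ((0 : ℕ) + ν + 1))⁻¹ (Real.Gamma ((1 : ℕ) + ν + 1))⁻¹ := by
    rcases Nat.eq_zero_or_pos m with rfl | hm
    · exact le_max_left _ _
    · induction m, hm using Nat.le_induction with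
      | base => exact le_max_right _ _
      | succ m hm ih => exact (hstep m hm).trans ih
  rw [besselCoeff, abs_div, abs_pow, abs_neg, abs_one, one_pow,
    abs_of_pos (mul_pos (by positivity) (hG m)), one_div, mul_inv, mul_comm, one_div]
  gcongr

theorem summable_besselCoeff {ν : ℝ} (hν : -1 < ν) (w : ℝ) :
    Summable fun m => |besselCoeff ν m| * |w| ^ m := by
  obtain ⟨K, hK⟩ := exists_abs_besselCoeff_le hν
  refine Summable.of_nonneg_of_le (fun m => by positivity) (fun m => ?_)
    ((Real.summable_pow_div_factorial |w|).mul_left K)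
  calc |besselCoeff ν m| * |w| ^ m ≤ (K * (1 / (m.factorial : ℝ))) * |w| ^ m := by
        gcongr; exact hK m
    _ = K * (|w| ^ m / m.factorial) := by ring

theorem hasSum_besselPhi {ν : ℝ} (hν : -1 < ν) (w : ℝ) :
    HasSum (fun m => besselCoeff ν m * w ^ m) (besselPhi ν w) :=
  (Summable.of_norm (by simpa [abs_mul] using summable_besselCoeff hν w)).hasSum

theorem hasDerivAt_besselPhi {ν : ℝ} (hν : -1 < ν) (w : ℝ) :
    HasDerivAt (besselPhi ν) (-besselPhi (ν + 1) w) w := by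
  set R := |w| + 1 with hR
  have hR0 : 0 ≤ R := by positivity
  have hshift : ∀ y : ℝ, ∀ m : ℕ, besselCoeff ν (m + 1) * (((m + 1 : ℕ) : ℝ) * y ^ (m + 1 - 1)) =
      -(besselCoeff (ν + 1) m * y ^ m) := fun y m => by
    rw [← mul_assoc, besselCoeff_succ_mul, Nat.add_sub_cancel, neg_mul]
  have hu : Summable fun m : ℕ => |besselCoeff ν m * ((m : ℝ) * R ^ (m - 1))| := by
    rw [← summable_nat_add_iff 1]
    have h := summable_besselCoeff (ν := ν + 1) (by linarith) R
    refine h.congr fun m => ?_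
    rw [hshift, abs_neg, abs_mul, abs_pow]
  have h := hasDerivAt_tsum_of_isPreconnected (t := Metric.ball (0 : ℝ) R)
    (g := fun m w => besselCoeff ν m * w ^ m)
    (g' := fun m w => besselCoeff ν m * ((m : ℝ) * w ^ (m - 1))) (y₀ := 0) (y := w) hu
    Metric.isOpen_ball (convex_ball _ _).isPreconnected
    (fun m y _ => (hasDerivAt_pow m y).const_mul _)
    (fun m y hy => by
      have hy' : |y| ≤ R := by
        rw [Metric.mem_ball, dist_zero_right] at hy
        exact hy.le
      rw [Real.norm_eq_abs, abs_mul, abs_mul, abs_mul, abs_mul, abs_pow, abs_pow,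
        abs_of_nonneg hR0]
      gcongr)
    (by simp [hR]; positivity) (hasSum_besselPhi hν 0).summable (by simp [hR])
  convert! h using 1
  have hs : Summable fun m : ℕ => besselCoeff ν m * ((m : ℝ) * w ^ (m - 1)) := by
    rw [← summable_nat_add_iff 1]
    exact ((hasSum_besselPhi (ν := ν + 1) (by linarith) w).summable.neg).congr
      fun m => (hshift w m).symm
  rw [hs.tsum_eq_zero_add]
  simp only [hshift]
  rw [tsum_neg]
  simp [besselPhi]

/-- The three-term recurrence `J_ν + J_{ν+2} = (2(ν+1)/x) J_{ν+1}`, in terms of `Φ`. -/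
theorem besselPhi_recurrence {ν : ℝ} (hν : -1 < ν) (w : ℝ) :
    (ν + 1) * besselPhi (ν + 1) w = besselPhi ν w + w * besselPhi (ν + 2) w := by
  have h0 := hasSum_besselPhi hν w
  have h1 := hasSum_besselPhi (ν := ν + 1) (by linarith) w
  have h2 := hasSum_besselPhi (ν := ν + 2) (by linarith) w
  have h3 : HasSum (fun m : ℕ => besselCoeff (ν + 1) m * (m : ℝ) * w ^ m)
      (-(w * besselPhi (ν + 2) w)) := by
    rw [← hasSum_nat_add_iff' 1]
    have h4 := (h2.mul_left w).neg
    simp only [Finset.sum_range_one, Nat.cast_zero, mul_zero, zero_mul, sub_zero]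
    convert! h4 using 1
    ext m
    rw [besselCoeff_succ_mul, pow_succ, show ν + 1 + 1 = ν + 2 by ring]
    ring
  have h5 : HasSum (fun m : ℕ => besselCoeff ν m * w ^ m)
      ((ν + 1) * besselPhi (ν + 1) w + -(w * besselPhi (ν + 2) w)) := by
    have h6 := (h1.mul_left (ν + 1)).add h3
    convert! h6 using 1
    ext m
    have hm : (0 : ℝ) ≤ m := m.cast_nonneg
    have e1 : (m : ℝ) + (ν + 1) + 1 = ((m : ℝ) + ν + 1) + 1 := by ring
    have hne : (m : ℝ) + ν + 1 ≠ 0 := by linarith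
    have hG : Real.Gamma ((m : ℝ) + ν + 1) ≠ 0 := (Real.Gamma_pos_of_pos (by linarith)).ne'
    unfold besselCoeff
    rw [e1, Real.Gamma_add_one hne]
    field_simp
    ring
  have := h0.unique h5
  linarith

theorem analyticOnNhd_besselPhi {ν : ℝ} (hν : -1 < ν) :
    AnalyticOnNhd ℝ (besselPhi ν) Set.univ := by
  set p := FormalMultilinearSeries.ofScalars ℝ (besselCoeff ν) with hp
  have hrad : p.radius = ⊤ := by
    rw [FormalMultilinearSeries.radius_eq_top_iff_summable_norm]
    intro r
    refine (summable_besselCoeff hν r).congr fun m => ?_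
    rw [hp, FormalMultilinearSeries.ofScalars_norm]
    simp
  have h := p.hasFPowerSeriesOnBall (by rw [hrad]; simp)
  have h2 := h.analyticOnNhd
  rw [hrad] at h2
  have h3 : p.sum = besselPhi ν := by
    ext w
    rw [FormalMultilinearSeries.sum, besselPhi]
    refine tsum_congr fun m => ?_
    rw [hp]
    simp [FormalMultilinearSeries.ofScalars]
  rw [h3] at h2
  intro x _
  exact h2 x (by simp)

/-- The even entire function `G_ν` with `J_ν(x) = (x/2)^ν G_ν(x)`. -/
def besselG (ν x : ℝ) : ℝ := besselPhi ν ((x / 2) ^ 2)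

theorem hasDerivAt_besselG {ν : ℝ} (hν : -1 < ν) (x : ℝ) :
    HasDerivAt (besselG ν) (-(x / 2) * besselG (ν + 1) x) x := by
  have h1 : HasDerivAt (fun x : ℝ => (x / 2) ^ 2) (x / 2) x := by
    convert! ((hasDerivAt_id x).div_const 2).pow 2 using 1
    simp; ring
  convert! (hasDerivAt_besselPhi hν ((x / 2) ^ 2)).comp x h1 using 1
  simp [besselG]; ring

theorem continuous_besselG {ν : ℝ} (hν : -1 < ν) : Continuous (besselG ν) :=
  continuous_iff_continuousAt.mpr fun x => (hasDerivAt_besselG hν x).continuousAt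

theorem besselG_recurrence {ν : ℝ} (hν : -1 < ν) (x : ℝ) :
    (ν + 1) * besselG (ν + 1) x = besselG ν x + (x / 2) ^ 2 * besselG (ν + 2) x :=
  besselPhi_recurrence hν _

theorem besselG_zero_ne_zero {ν : ℝ} (hν : -1 < ν) : besselG ν 0 ≠ 0 := by
  have h := hasSum_besselPhi hν 0
  have h0 : besselPhi ν 0 = besselCoeff ν 0 := by
    rw [besselPhi, tsum_eq_single 0]
    · simp
    · intro m hm; simp [hm]
  have e : besselG ν 0 = besselPhi ν 0 := by rw [besselG]; norm_num
  rw [e, h0]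
  exact besselCoeff_zero_ne_zero hν

theorem eventually_besselG_ne_zero {ν : ℝ} (hν : -1 < ν) (x : ℝ) :
    ∀ᶠ y in 𝓝[≠] x, besselG ν y ≠ 0 := by
  have ha : AnalyticOnNhd ℝ (besselG ν) Set.univ := fun x _ =>
    (analyticOnNhd_besselPhi hν _ trivial).comp (f := fun x : ℝ => (x / 2) ^ 2) (by fun_prop)
  by_contra hcon
  have hf : ∃ᶠ y in 𝓝[≠] x, besselG ν y = 0 := by
    exact fun h => hcon h
  exact besselG_zero_ne_zero hν
    (ha.eqOn_zero_of_preconnected_of_frequently_eq_zero isPreconnected_univ trivial hf trivial)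

theorem besselJ_eq {ν y : ℝ} (hy : 0 < y) : besselJ ν y = (y / 2) ^ ν * besselG ν y := by
  rw [besselJ, besselG, besselPhi, ← tsum_mul_left]
  refine tsum_congr fun m => ?_
  have h2 : (0 : ℝ) < y / 2 := by positivity
  rw [Real.rpow_add h2, besselCoeff, ← pow_mul]
  have : (y / 2) ^ (2 * (m : ℝ)) = (y / 2) ^ (2 * m) := by
    rw [← Real.rpow_natCast]; push_cast; rfl
  rw [this]
  ring

theorem besselJ_eq_zero_iff {ν y : ℝ} (hy : 0 < y) : besselJ ν y = 0 ↔ besselG ν y = 0 := by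
  have h2 : (0 : ℝ) < (y / 2) ^ ν := Real.rpow_pos_of_pos (by positivity) _
  rw [besselJ_eq hy, mul_eq_zero_iff_left h2.ne']

/-! ### Enumeration of the zeros -/

theorem besselZero_nonneg (ν : ℝ) (n : ℕ) : 0 ≤ besselZero ν n := by
  induction n with
  | zero => simp [besselZero]
  | succ n ih => exact Real.sInf_nonneg fun y hy => ih.trans hy.1.le

theorem besselZero_succ_le {ν y : ℝ} {n : ℕ} (hy : besselZero ν n < y) (h0 : besselG ν y = 0) :
    besselZero ν (n + 1) ≤ y :=
  csInf_le ⟨besselZero ν n, fun _ hz => hz.1.le⟩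
    ⟨hy, (besselJ_eq_zero_iff ((besselZero_nonneg ν n).trans_lt hy)).mpr h0⟩

/-- Since the zeros are isolated, the infimum in the recursion is a minimum. -/
theorem besselZero_succ_spec {ν : ℝ} (hν : -1 < ν) (h : ∀ a, ∃ y, a < y ∧ besselG ν y = 0) (n : ℕ) :
    besselZero ν n < besselZero ν (n + 1) ∧ besselG ν (besselZero ν (n + 1)) = 0 := by
  set S := {y : ℝ | besselZero ν n < y ∧ besselJ ν y = 0} with hS
  have hSG : ∀ y ∈ S, besselG ν y = 0 := fun y hy =>
    (besselJ_eq_zero_iff ((besselZero_nonneg ν n).trans_lt hy.1)).mp hy.2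
  have hne : S.Nonempty := by
    obtain ⟨y, hy, h0⟩ := h (besselZero ν n)
    exact ⟨y, hy, (besselJ_eq_zero_iff ((besselZero_nonneg ν n).trans_lt hy)).mpr h0⟩
  have hbdd : BddBelow S := ⟨besselZero ν n, fun _ hz => hz.1.le⟩
  have hmem : sInf S ∈ S := by
    by_contra hnot
    have hcl := mem_closure_iff_frequently.mp (csInf_mem_closure hne hbdd)
    have hfr : ∃ᶠ y in 𝓝[≠] sInf S, besselG ν y = 0 := by
      rw [frequently_nhdsWithin_iff]
      exact hcl.mono fun y hy => ⟨hSG y hy, fun e => hnot (e ▸ hy)⟩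
    exact hfr (eventually_besselG_ne_zero hν _)
  exact ⟨hmem.1, hSG _ hmem⟩

/-! ### Sturm comparison and interlacing -/

theorem exists_constant_sign {f : ℝ → ℝ} {s : Set ℝ} (hs : IsPreconnected s) (hf : ContinuousOn f s)
    (h0 : ∀ x ∈ s, f x ≠ 0) : ∃ ε : ℝ, (ε = 1 ∨ ε = -1) ∧ ∀ x ∈ s, 0 < ε * f x := by
  by_cases h : ∀ x ∈ s, 0 < f x
  · exact ⟨1, Or.inl rfl, fun x hx => by simpa using h x hx⟩
  · push Not at h
    obtain ⟨x, hx, hfx⟩ := h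
    refine ⟨-1, Or.inr rfl, fun y hy => ?_⟩
    by_contra hcon
    have hy0 : 0 ≤ f y := by linarith
    obtain ⟨z, hz, hz0⟩ := hs.intermediate_value hx hy hf ⟨hfx, hy0⟩
    exact h0 z hz hz0

/-- `√x J_ν(x)`, up to a constant factor. -/
def besselU (ν x : ℝ) : ℝ := x ^ (ν + 1 / 2) * besselG ν x

/-- The derivative of `besselU ν`. -/
def besselV (ν x : ℝ) : ℝ :=
  x ^ (ν - 1 / 2) * ((ν + 1 / 2) * besselG ν x - x ^ 2 / 2 * besselG (ν + 1) x)

theorem hasDerivAt_besselU {ν x : ℝ} (hν : -1 < ν) (hx : 0 < x) :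
    HasDerivAt (besselU ν) (besselV ν x) x := by
  have h := (Real.hasDerivAt_rpow_const (x := x) (p := ν + 1 / 2) (Or.inl hx.ne')).mul
    (hasDerivAt_besselG hν x)
  convert! h using 1
  have e : x ^ (ν + 1 / 2) = x ^ (ν - 1 / 2) * x := by
    rw [← Real.rpow_add_one hx.ne']; congr 1; ring
  rw [besselV, e, show ν + 1 / 2 - 1 = ν - 1 / 2 by ring]
  ring

/-- Bessel's equation in Liouville normal form: `u'' = ((ν² - 1/4)/x² - 1) u`. -/
theorem hasDerivAt_besselV {ν x : ℝ} (hν : -1 < ν) (hx : 0 < x) :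
    HasDerivAt (besselV ν) (((ν ^ 2 - 1 / 4) / x ^ 2 - 1) * besselU ν x) x := by
  have hG := hasDerivAt_besselG hν x
  have hG1 := hasDerivAt_besselG (ν := ν + 1) (by linarith) x
  have hsq : HasDerivAt (fun x : ℝ => x ^ 2 / 2) x x := by
    convert! (hasDerivAt_pow 2 x).div_const 2 using 1
    simp
  have h := (Real.hasDerivAt_rpow_const (x := x) (p := ν - 1 / 2) (Or.inl hx.ne')).mul
    ((hG.const_mul (ν + 1 / 2)).sub (hsq.mul hG1))
  convert! h using 1
  have hrec := besselG_recurrence hν x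
  have e1 : x ^ (ν + 1 / 2) = x ^ (ν - 1 / 2 - 1) * x ^ 2 := by
    rw [← Real.rpow_natCast, ← Real.rpow_add hx]; congr 1; push_cast; ring
  have e2 : x ^ (ν - 1 / 2) = x ^ (ν - 1 / 2 - 1) * x := by
    rw [← Real.rpow_add_one hx.ne']; congr 1; ring
  rw [besselU, e1, e2, show ν + 1 + 1 = ν + 2 by ring]
  have hrec' : besselG ν x = (ν + 1) * besselG (ν + 1) x - (x / 2) ^ 2 * besselG (ν + 2) x := by
    linarith
  simp only [Pi.sub_apply, Pi.mul_apply]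
  rw [hrec']
  field_simp
  ring

/-- The Wronskian of `√x J_ν(x)` and `sin (x - a)`. -/
def besselW (ν a x : ℝ) : ℝ := besselV ν x * Real.sin (x - a) - besselU ν x * Real.cos (x - a)

theorem hasDerivAt_besselW {ν a x : ℝ} (hν : -1 < ν) (hx : 0 < x) :
    HasDerivAt (besselW ν a) ((ν ^ 2 - 1 / 4) / x ^ 2 * (besselU ν x * Real.sin (x - a))) x := by
  have hs : HasDerivAt (fun x => Real.sin (x - a)) (Real.cos (x - a)) x := by
    simpa using ((hasDerivAt_id x).sub_const a).sin
  have hc : HasDerivAt (fun x => Real.cos (x - a)) (-Real.sin (x - a)) x := by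
    simpa using ((hasDerivAt_id x).sub_const a).cos
  convert! ((hasDerivAt_besselV hν hx).mul hs).sub ((hasDerivAt_besselU hν hx).mul hc) using 1
  ring

theorem tendsto_besselW {ν a : ℝ} (hν : -(1 / 2) < ν) (ha : 0 ≤ a) :
    Tendsto (besselW ν a) (𝓝[>] a) (𝓝 (-besselU ν a)) := by
  rcases ha.eq_or_lt with rfl | ha
  · -- near `0` the factor `x ^ (ν - 1/2)` of `V` is compensated by `sin x`
    have hc : Continuous fun x : ℝ => x ^ (ν + 1 / 2) *
        (((ν + 1 / 2) * besselG ν x - x ^ 2 / 2 * besselG (ν + 1) x) * Real.sinc x -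
          besselG ν x * Real.cos x) := by
      have h1 := continuous_besselG (ν := ν) (by linarith)
      have h2 := continuous_besselG (ν := ν + 1) (by linarith)
      have h3 := Real.continuous_sinc
      have h4 : Continuous fun x : ℝ => x ^ (ν + 1 / 2) :=
        Real.continuous_rpow_const (by linarith)
      fun_prop
    have h0 : -besselU ν 0 = 0 := by
      rw [besselU, Real.zero_rpow (by linarith)]; simp
    have h := hc.tendsto 0
    rw [Real.zero_rpow (by linarith), zero_mul] at h
    rw [h0]
    refine (h.mono_left nhdsWithin_le_nhds).congr' ?_
    filter_upwards [self_mem_nhdsWithin] with x hx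
    have hx' : x ≠ 0 := (Set.mem_Ioi.mp hx).ne'
    have e : x ^ (ν + 1 / 2) = x ^ (ν - 1 / 2) * x := by
      rw [← Real.rpow_add_one hx']; congr 1; ring
    rw [besselW, besselU, besselV, sub_zero, e, Real.sinc_of_ne_zero hx']
    field_simp
  · have h := (hasDerivAt_besselW (ν := ν) (a := a) (by linarith) ha).continuousAt.tendsto
    have e : besselW ν a a = -besselU ν a := by simp [besselW]
    rw [e] at h
    exact h.mono_left nhdsWithin_le_nhds

/-- Sturm comparison with `sin (x - a)`: for `|ν| ≤ 1/2` the function `√x J_ν(x)` oscillates at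
least as fast as the sine. -/
theorem exists_besselG_zero_Ioc {ν a : ℝ} (hν : -(1 / 2) < ν) (hν' : ν ≤ 1 / 2) (ha : 0 ≤ a) :
    ∃ x ∈ Set.Ioc a (a + Real.pi), besselG ν x = 0 := by
  by_contra! hne
  have hpi := Real.pi_pos
  have hν1 : -1 < ν := by linarith
  obtain ⟨ε, -, hε⟩ := exists_constant_sign isPreconnected_Ioc
    (continuous_besselG hν1).continuousOn hne
  have hU : ∀ x ∈ Set.Ioc a (a + Real.pi), 0 < ε * besselU ν x := fun x hx => by
    have h1 := hε x hx
    have h2 : 0 < x ^ (ν + 1 / 2) := Real.rpow_pos_of_pos (ha.trans_lt hx.1) _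
    rw [besselU, mul_left_comm]
    exact mul_pos h2 h1
  have hUa : 0 ≤ ε * besselU ν a := by
    have hc : Continuous fun x => ε * besselU ν x := by
      have h1 := continuous_besselG hν1
      have h4 : Continuous fun x : ℝ => x ^ (ν + 1 / 2) :=
        Real.continuous_rpow_const (by linarith)
      unfold besselU
      fun_prop
    refine ge_of_tendsto ((hc.tendsto a).mono_left (nhdsWithin_le_nhds (s := Set.Ioi a))) ?_
    filter_upwards [Ioc_mem_nhdsGT (by linarith : a < a + Real.pi)] with x hx using (hU x hx).le
  have hanti : AntitoneOn (fun x => ε * besselW ν a x) (Set.Ioc a (a + Real.pi)) := by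
    have hd : ∀ x ∈ Set.Ioc a (a + Real.pi), HasDerivAt (fun x => ε * besselW ν a x)
        (ε * ((ν ^ 2 - 1 / 4) / x ^ 2 * (besselU ν x * Real.sin (x - a)))) x := fun x hx =>
      (hasDerivAt_besselW hν1 (ha.trans_lt hx.1)).const_mul ε
    refine antitoneOn_of_deriv_nonpos (convex_Ioc _ _)
      (fun x hx => (hd x hx).continuousAt.continuousWithinAt)
      (fun x hx => (hd x (interior_subset hx)).differentiableAt.differentiableWithinAt)
      fun x hx => ?_
    have hx' := interior_subset hx
    rw [(hd x hx').deriv]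
    have h1 : (ν ^ 2 - 1 / 4) / x ^ 2 ≤ 0 :=
      div_nonpos_of_nonpos_of_nonneg (by nlinarith) (sq_nonneg _)
    have h2 : 0 ≤ Real.sin (x - a) :=
      Real.sin_nonneg_of_nonneg_of_le_pi (by linarith [hx'.1]) (by linarith [hx'.2])
    have h3 := mul_nonneg (hU x hx').le h2
    calc ε * ((ν ^ 2 - 1 / 4) / x ^ 2 * (besselU ν x * Real.sin (x - a)))
        = (ν ^ 2 - 1 / 4) / x ^ 2 * (ε * besselU ν x * Real.sin (x - a)) := by ring
      _ ≤ 0 := mul_nonpos_of_nonpos_of_nonneg h1 h3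
  have hend : (a + Real.pi) ∈ Set.Ioc a (a + Real.pi) := ⟨by linarith, le_rfl⟩
  have hle : ε * besselW ν a (a + Real.pi) ≤ ε * (-besselU ν a) := by
    refine ge_of_tendsto ((tendsto_besselW hν ha).const_mul ε) ?_
    filter_upwards [Ioc_mem_nhdsGT (by linarith : a < a + Real.pi)] with x hx
    exact hanti hx hend hx.2
  have hW : besselW ν a (a + Real.pi) = besselU ν (a + Real.pi) := by simp [besselW]
  rw [hW] at hle
  have := hU _ hend
  linarith

/-- Sturm comparison with `sin (x - a)`: for `ν > 1/2` the function `√x J_ν(x)` oscillates more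
slowly than the sine. Here `a` may be `0`, where `√x J_ν(x)` vanishes. -/
theorem pi_le_sub_of_besselU_eq_zero {ν a b : ℝ} (hν : 1 / 2 < ν) (ha : 0 ≤ a) (hab : a < b)
    (h0 : besselU ν a = 0) (hb : besselG ν b = 0) (hne : ∀ x ∈ Set.Ioo a b, besselG ν x ≠ 0) :
    Real.pi ≤ b - a := by
  by_contra! hlt
  have hν1 : -1 < ν := by linarith
  obtain ⟨ε, -, hε⟩ := exists_constant_sign isPreconnected_Ioo
    (continuous_besselG hν1).continuousOn hne
  have hU : ∀ x ∈ Set.Ioo a b, 0 < ε * besselU ν x := fun x hx => by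
    have h1 := hε x hx
    have h2 : 0 < x ^ (ν + 1 / 2) := Real.rpow_pos_of_pos (ha.trans_lt hx.1) _
    rw [besselU, mul_left_comm]
    exact mul_pos h2 h1
  have hmono : StrictMonoOn (fun x => ε * besselW ν a x) (Set.Ioc a b) := by
    have hd : ∀ x ∈ Set.Ioc a b, HasDerivAt (fun x => ε * besselW ν a x)
        (ε * ((ν ^ 2 - 1 / 4) / x ^ 2 * (besselU ν x * Real.sin (x - a)))) x := fun x hx =>
      (hasDerivAt_besselW hν1 (ha.trans_lt hx.1)).const_mul ε
    refine strictMonoOn_of_deriv_pos (convex_Ioc _ _)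
      (fun x hx => (hd x hx).continuousAt.continuousWithinAt) fun x hx => ?_
    have hx' := interior_subset hx
    rw [interior_Ioc] at hx
    rw [(hd x hx').deriv]
    have h1 : 0 < (ν ^ 2 - 1 / 4) / x ^ 2 :=
      div_pos (by nlinarith) (pow_pos (ha.trans_lt hx.1) 2)
    have h2 : 0 < Real.sin (x - a) :=
      Real.sin_pos_of_pos_of_lt_pi (by linarith [hx.1]) (by linarith [hx.2])
    have h3 := mul_pos (hU x hx) h2
    calc 0 < (ν ^ 2 - 1 / 4) / x ^ 2 * (ε * besselU ν x * Real.sin (x - a)) := mul_pos h1 h3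
      _ = ε * ((ν ^ 2 - 1 / 4) / x ^ 2 * (besselU ν x * Real.sin (x - a))) := by ring
  set c := (a + b) / 2 with hc
  have hca : a < c := by linarith
  have hcb : c < b := by linarith
  have hWc : 0 ≤ ε * besselW ν a c := by
    have ht := (tendsto_besselW (ν := ν) (by linarith) ha).const_mul ε
    rw [h0, neg_zero, mul_zero] at ht
    refine le_of_tendsto ht ?_
    filter_upwards [Ioc_mem_nhdsGT hca] with x hx
    exact hmono.monotoneOn ⟨hx.1, hx.2.trans hcb.le⟩ ⟨hca, hcb.le⟩ hx.2
  have hWb : 0 < ε * besselW ν a b := hWc.trans_lt (hmono ⟨hca, hcb.le⟩ ⟨hab, le_rfl⟩ hcb)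
  have hUb : besselU ν b = 0 := by rw [besselU, hb, mul_zero]
  have hsin : 0 < Real.sin (b - a) := Real.sin_pos_of_pos_of_lt_pi (by linarith) hlt
  have hVb : 0 < ε * besselV ν b := by
    rw [besselW, hUb, zero_mul, sub_zero, ← mul_assoc] at hWb
    exact pos_of_mul_pos_left hWb hsin.le
  -- but `ε u` is positive to the left of its zero `b`, so its derivative there is not positive
  have hder := ((hasDerivAt_besselU hν1 (ha.trans_lt hab)).const_mul ε)
  have hslope := hasDerivAt_iff_tendsto_slope.mp hder
  have hle : ε * besselV ν b ≤ 0 := by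
    refine le_of_tendsto (hslope.mono_left (nhdsWithin_mono b
      (fun x (hx : x < b) => hx.ne) : 𝓝[<] b ≤ 𝓝[≠] b)) ?_
    filter_upwards [Ioo_mem_nhdsLT hab] with x hx
    rw [slope_def_field, hUb, mul_zero]
    exact div_nonpos_of_nonneg_of_nonpos (by linarith [hU x hx]) (by linarith [hx.2])
  linarith

/-- Rolle for `G_ν`: zeros of `J_{ν+1}` separate those of `J_ν`. -/
theorem exists_besselG_succ_zero {ν a b : ℝ} (hν : -1 < ν) (ha : 0 < a) (hab : a < b)
    (h0 : besselG ν a = 0) (hb : besselG ν b = 0) :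
    ∃ x ∈ Set.Ioo a b, besselG (ν + 1) x = 0 := by
  obtain ⟨c, hc, hc0⟩ := exists_hasDerivAt_eq_zero hab (continuous_besselG hν).continuousOn
    (h0.trans hb.symm) (fun x _ => hasDerivAt_besselG hν x)
  refine ⟨c, hc, (mul_eq_zero.mp hc0).resolve_left ?_⟩
  have : 0 < c := ha.trans hc.1
  linarith

/-- Rolle for `x ^ (2ν + 2) G_{ν+1}`: zeros of `J_ν` separate those of `J_{ν+1}`, and one precedes
the first positive zero of `J_{ν+1}`. -/
theorem exists_besselG_zero_of_succ {ν a b : ℝ} (hν : -1 < ν) (ha : 0 ≤ a) (hab : a < b)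
    (h0 : a = 0 ∨ besselG (ν + 1) a = 0) (hb : besselG (ν + 1) b = 0) :
    ∃ x ∈ Set.Ioo a b, besselG ν x = 0 := by
  have hc : Continuous fun x : ℝ => x ^ (2 * ν + 2) * besselG (ν + 1) x := by
    have h1 := continuous_besselG (ν := ν + 1) (by linarith)
    have h4 : Continuous fun x : ℝ => x ^ (2 * ν + 2) := Real.continuous_rpow_const (by linarith)
    fun_prop
  have hd : ∀ x ∈ Set.Ioo a b, HasDerivAt (fun x : ℝ => x ^ (2 * ν + 2) * besselG (ν + 1) x)
      (2 * x ^ (2 * ν + 1) * besselG ν x) x := fun x hx => by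
    have hx0 : 0 < x := ha.trans_lt hx.1
    convert! (Real.hasDerivAt_rpow_const (x := x) (p := 2 * ν + 2) (Or.inl hx0.ne')).mul
      (hasDerivAt_besselG (ν := ν + 1) (by linarith) x) using 1
    have e : x ^ (2 * ν + 2) = x ^ (2 * ν + 1) * x := by
      rw [← Real.rpow_add_one hx0.ne']; congr 1; ring
    rw [e, show ν + 1 + 1 = ν + 2 by ring, show 2 * ν + 2 - 1 = 2 * ν + 1 by ring]
    have hrec := besselG_recurrence hν x
    have hrec' : besselG ν x = (ν + 1) * besselG (ν + 1) x - (x / 2) ^ 2 * besselG (ν + 2) x := by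
      linarith
    rw [hrec']
    ring
  obtain ⟨c, hc, hc0⟩ := exists_hasDerivAt_eq_zero hab hc.continuousOn (by
    rw [hb, mul_zero]
    rcases h0 with rfl | h0
    · rw [Real.zero_rpow (by linarith), zero_mul]
    · rw [h0, mul_zero]) hd
  refine ⟨c, hc, (mul_eq_zero.mp hc0).resolve_left ?_⟩
  have : 0 < c ^ (2 * ν + 1) := Real.rpow_pos_of_pos (ha.trans_lt hc.1) _
  linarith

/-- A property of all orders `ν > r` may be proved on `(r, r + 1]` and carried upwards in steps
of `1`. -/
theorem induction_on_order {P : ℝ → Prop} (r : ℝ) (h0 : ∀ ν, r < ν → ν ≤ r + 1 → P ν)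
    (h1 : ∀ ν, r < ν → P ν → P (ν + 1)) {ν : ℝ} (hν : r < ν) : P ν := by
  have key : ∀ n : ℕ, ∀ ν : ℝ, r < ν → ν ≤ r + 1 + n → P ν := fun n => by
    induction n with
    | zero => exact fun ν h h' => h0 ν h (by simpa using h')
    | succ n ih =>
      intro ν h h'
      by_cases hle : ν ≤ r + 1
      · exact h0 ν h hle
      · have h2 := h1 (ν - 1) (by linarith)
          (ih (ν - 1) (by linarith) (by push_cast at h'; linarith))
        simpa using h2
  obtain ⟨n, hn⟩ := exists_nat_ge (ν - (r + 1))
  exact key n ν hν (by linarith)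

/-- For `ν > -1/2` the positive zeros of `J_ν` are unbounded. -/
theorem exists_besselG_zero_gt {ν : ℝ} (hν : -(1 / 2) < ν) :
    ∀ a, ∃ y, a < y ∧ besselG ν y = 0 := by
  refine induction_on_order (P := fun ν => ∀ a, ∃ y, a < y ∧ besselG ν y = 0) (-(1 / 2))
    (fun ν h1 h2 a => ?_) (fun ν h1 ih a => ?_) hν
  · obtain ⟨x, hx, h0⟩ := exists_besselG_zero_Ioc h1 (by linarith) (le_max_right a 0)
    exact ⟨x, (le_max_left a 0).trans_lt hx.1, h0⟩
  · obtain ⟨y, hy, hy0⟩ := ih (max a 0)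
    obtain ⟨z, hz, hz0⟩ := ih y
    obtain ⟨x, hx, hx0⟩ := exists_besselG_succ_zero (by linarith)
      ((le_max_right a 0).trans_lt hy) hz hy0 hz0
    exact ⟨x, ((le_max_left a 0).trans_lt hy).trans hx.1, hx0⟩

theorem besselZero_lt_succ {ν : ℝ} (hν : -(1 / 2) < ν) (n : ℕ) :
    besselZero ν n < besselZero ν (n + 1) :=
  (besselZero_succ_spec (by linarith) (exists_besselG_zero_gt hν) n).1

theorem besselG_besselZero {ν : ℝ} (hν : -(1 / 2) < ν) {n : ℕ} (hn : n ≠ 0) :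
    besselG ν (besselZero ν n) = 0 := by
  obtain ⟨m, rfl⟩ := Nat.exists_eq_succ_of_ne_zero hn
  exact (besselZero_succ_spec (by linarith) (exists_besselG_zero_gt hν) m).2

theorem besselZero_le_mul_pi {ν : ℝ} (hν : -(1 / 2) < ν) (hν' : ν ≤ 1 / 2) (n : ℕ) :
    besselZero ν n ≤ n * Real.pi := by
  induction n with
  | zero => simp [besselZero]
  | succ n ih =>
    obtain ⟨x, hx, h0⟩ := exists_besselG_zero_Ioc hν hν' (a := n * Real.pi)
      (by have := Real.pi_pos; positivity)
    refine (besselZero_succ_le (ih.trans_lt hx.1) h0).trans (hx.2.trans_eq ?_)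
    push_cast; ring

theorem besselZero_add_pi_le {ν : ℝ} (hν : 1 / 2 < ν) (n : ℕ) :
    besselZero ν n + Real.pi ≤ besselZero ν (n + 1) := by
  have hν' : -(1 / 2) < ν := by linarith
  have h := pi_le_sub_of_besselU_eq_zero hν (besselZero_nonneg ν n) (besselZero_lt_succ hν' n) ?_
    (besselG_besselZero hν' (Nat.succ_ne_zero n)) ?_
  · linarith
  · rcases Nat.eq_zero_or_pos n with rfl | hn
    · rw [besselU, besselZero, Real.zero_rpow (by linarith), zero_mul]
    · rw [besselU, besselG_besselZero hν' hn.ne', mul_zero]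
  · intro x hx h0
    exact absurd (besselZero_succ_le hx.1 h0) (not_le.mpr hx.2)

theorem mul_pi_le_besselZero {ν : ℝ} (hν : 1 / 2 < ν) (n : ℕ) :
    n * Real.pi ≤ besselZero ν n := by
  induction n with
  | zero => simp [besselZero]
  | succ n ih =>
    have := besselZero_add_pi_le hν n
    push_cast
    linarith

theorem besselZero_lt_besselZero_succ_order {ν : ℝ} (hν : -(1 / 2) < ν) {n : ℕ} (hn : 1 ≤ n) :
    besselZero ν n < besselZero (ν + 1) n := by
  have hν1 : -(1 / 2) < ν + 1 := by linarith
  have hstep : ∀ n, besselZero ν n ≤ besselZero (ν + 1) n →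
      besselZero ν (n + 1) < besselZero (ν + 1) (n + 1) := fun n h => by
    obtain ⟨x, hx, h0⟩ := exists_besselG_zero_of_succ (ν := ν) (by linarith)
      (besselZero_nonneg (ν + 1) n) (besselZero_lt_succ hν1 n) (by
        rcases Nat.eq_zero_or_pos n with rfl | hn
        · left; rfl
        · right; exact besselG_besselZero hν1 hn.ne')
      (besselG_besselZero hν1 (Nat.succ_ne_zero n))
    exact (besselZero_succ_le (h.trans_lt hx.1) h0).trans_lt hx.2
  induction n, hn using Nat.le_induction with
  | base => exact hstep 0 le_rfl
  | succ n hn ih => exact hstep n ih.le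

theorem besselZero_succ_order_lt {ν : ℝ} (hν : -(1 / 2) < ν) (n : ℕ) :
    besselZero (ν + 1) n < besselZero ν (n + 1) := by
  induction n with
  | zero => exact besselZero_lt_succ hν 0
  | succ n ih =>
    obtain ⟨x, hx, h0⟩ := exists_besselG_succ_zero (ν := ν) (by linarith)
      ((besselZero_nonneg ν n).trans_lt (besselZero_lt_succ hν n)) (besselZero_lt_succ hν (n + 1))
      (besselG_besselZero hν (Nat.succ_ne_zero n)) (besselG_besselZero hν (Nat.succ_ne_zero _))
    exact (besselZero_succ_le (ih.trans hx.1) h0).trans_lt hx.2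

/-! ### Poisson's integral -/

theorem continuous_one_sub_sq_rpow {a : ℝ} (ha : 0 ≤ a) :
    Continuous fun t : ℝ => (1 - t ^ 2) ^ a :=
  (Real.continuous_rpow_const ha).comp (by fun_prop)

/-- The recurrence for the even moments of `(1 - t²)^a`, from integrating the derivative of
`t^(2m+1) (1 - t²)^(a+1)`. -/
theorem integral_one_sub_sq_rpow_mul_pow_succ {a : ℝ} (ha : 0 < a) (m : ℕ) :
    (2 * m + 2 * a + 3) * ∫ t in (-1 : ℝ)..1, (1 - t ^ 2) ^ a * t ^ (2 * (m + 1)) =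
      (2 * m + 1) * ∫ t in (-1 : ℝ)..1, (1 - t ^ 2) ^ a * t ^ (2 * m) := by
  have hcont := continuous_one_sub_sq_rpow ha.le
  have hd : ∀ t ∈ Set.uIcc (-1 : ℝ) 1, HasDerivAt
      (fun t : ℝ => t ^ (2 * m + 1) * (1 - t ^ 2) ^ (a + 1))
      ((2 * m + 1) * ((1 - t ^ 2) ^ a * t ^ (2 * m)) -
        (2 * m + 2 * a + 3) * ((1 - t ^ 2) ^ a * t ^ (2 * (m + 1)))) t := fun t ht => by
    rw [Set.uIcc_of_le (by norm_num)] at ht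
    have h1 : HasDerivAt (fun t : ℝ => 1 - t ^ 2) (-(2 * t)) t := by
      simpa using (hasDerivAt_pow 2 t).const_sub 1
    have h2 := h1.rpow_const (p := a + 1) (Or.inr (by linarith))
    convert! (hasDerivAt_pow (2 * m + 1) t).mul h2 using 1
    have hnn : 0 ≤ 1 - t ^ 2 := by nlinarith [ht.1, ht.2]
    rw [Real.rpow_add_one' hnn (by linarith), add_sub_cancel_right, Nat.add_sub_cancel]
    push_cast
    ring
  have hi := intervalIntegral.integral_eq_sub_of_hasDerivAt hd
    (Continuous.intervalIntegrable (by fun_prop) _ _)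
  rw [intervalIntegral.integral_sub (Continuous.intervalIntegrable (by fun_prop) _ _)
    (Continuous.intervalIntegrable (by fun_prop) _ _), intervalIntegral.integral_const_mul,
    intervalIntegral.integral_const_mul] at hi
  have hz : ((1 : ℝ) - 1 ^ 2) ^ (a + 1) = 0 := by
    rw [one_pow, sub_self, Real.zero_rpow (by linarith)]
  have hz' : ((1 : ℝ) - (-1) ^ 2) ^ (a + 1) = 0 := by
    rw [neg_one_sq, sub_self, Real.zero_rpow (by linarith)]
  rw [hz, hz'] at hi
  linarith

/-- Poisson's integral for `J_ν`; the value of the positive constant plays no role. -/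
theorem exists_poisson_integral {ν : ℝ} (hν : 1 / 2 < ν) :
    ∃ K : ℝ, 0 < K ∧ ∀ x : ℝ,
      ∫ t in (-1 : ℝ)..1, (1 - t ^ 2) ^ (ν - 1 / 2) * Real.cos (x * t) = K * besselG ν x := by
  set a := ν - 1 / 2 with ha
  have ha0 : 0 < a := by linarith
  have hcont := continuous_one_sub_sq_rpow ha0.le
  set c : ℕ → ℝ := fun m => ∫ t in (-1 : ℝ)..1, (1 - t ^ 2) ^ a * t ^ (2 * m) with hc
  have hG : 0 < Real.Gamma (ν + 1) := Real.Gamma_pos_of_pos (by linarith)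
  have hc0 : 0 < c 0 := by
    refine intervalIntegral.intervalIntegral_pos_of_pos_on
      (Continuous.intervalIntegrable (by fun_prop) _ _) (fun t ht => ?_) (by norm_num)
    simp only [mul_zero, pow_zero, mul_one]
    exact Real.rpow_pos_of_pos (by nlinarith [ht.1, ht.2]) _
  refine ⟨c 0 * Real.Gamma (ν + 1), mul_pos hc0 hG, fun x => ?_⟩
  -- both sides have the same power series, by the recurrence for the moments `c m`
  have hcm : ∀ m : ℕ, c m / ((2 * m).factorial : ℝ) =
      c 0 * Real.Gamma (ν + 1) / (4 ^ m * ((m.factorial : ℝ) * Real.Gamma ((m : ℝ) + ν + 1))) := by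
    intro m
    induction m with
    | zero =>
      have : Real.Gamma ((0 : ℕ) + ν + 1) = Real.Gamma (ν + 1) := by simp
      rw [this]
      simp only [mul_zero, Nat.factorial_zero, Nat.cast_one, div_one, pow_zero, one_mul]
      field_simp
    | succ m ih =>
      have hm : (0 : ℝ) ≤ m := m.cast_nonneg
      have hrec := integral_one_sub_sq_rpow_mul_pow_succ ha0 m
      change (2 * m + 2 * a + 3) * c (m + 1) = (2 * m + 1) * c m at hrec
      have e1 : ((m + 1 : ℕ) : ℝ) + ν + 1 = ((m : ℝ) + ν + 1) + 1 := by push_cast; ring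
      have hne : (m : ℝ) + ν + 1 ≠ 0 := by linarith
      have hGm : Real.Gamma ((m : ℝ) + ν + 1) ≠ 0 := (Real.Gamma_pos_of_pos (by linarith)).ne'
      have hcs : c (m + 1) = (2 * m + 1) * c m / (2 * (m + ν + 1)) := by
        rw [eq_div_iff (by positivity), ← hrec, ha]
        ring
      rw [e1, Real.Gamma_add_one hne, show 2 * (m + 1) = 2 * m + 1 + 1 by ring,
        Nat.factorial_succ, Nat.factorial_succ, Nat.factorial_succ, hcs]
      have hf : ((2 * m).factorial : ℝ) ≠ 0 := by positivity
      rw [div_eq_iff hf] at ih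
      rw [ih]
      have h1 : (m : ℝ) + 1 ≠ 0 := by positivity
      have h2 : 2 * (m : ℝ) + 1 ≠ 0 := by positivity
      push_cast
      field_simp
      ring
  have hsum : HasSum (fun m : ℕ => ∫ t in (-1 : ℝ)..1, (1 - t ^ 2) ^ a *
      ((-1) ^ m * (x * t) ^ (2 * m) / ((2 * m).factorial : ℝ)))
      (∫ t in (-1 : ℝ)..1, (1 - t ^ 2) ^ a * Real.cos (x * t)) := by
    refine intervalIntegral.hasSum_integral_of_dominated_convergence
      (fun m _ => |x| ^ (2 * m) / ((2 * m).factorial : ℝ))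
      (fun m => Continuous.aestronglyMeasurable (by fun_prop)) (fun m => ?_) ?_ ?_ ?_
    · refine Filter.Eventually.of_forall fun t ht => ?_
      rw [Set.uIoc_of_le (by norm_num)] at ht
      have ht1 : |t| ≤ 1 := abs_le.mpr ⟨ht.1.le, ht.2⟩
      have hnn : 0 ≤ 1 - t ^ 2 := by nlinarith [ht.1, ht.2]
      have h1 : (1 - t ^ 2) ^ a ≤ 1 :=
        Real.rpow_le_one hnn (by nlinarith [sq_nonneg t]) ha0.le
      rw [Real.norm_eq_abs, abs_mul, abs_div, abs_mul, abs_pow, abs_neg, abs_one, one_pow, one_mul,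
        abs_pow, abs_mul, Nat.abs_cast, abs_of_nonneg (Real.rpow_nonneg hnn a)]
      calc (1 - t ^ 2) ^ a * ((|x| * |t|) ^ (2 * m) / ((2 * m).factorial : ℝ))
          ≤ 1 * ((|x| * 1) ^ (2 * m) / ((2 * m).factorial : ℝ)) := by gcongr
        _ = _ := by rw [one_mul, mul_one]
    · exact Filter.Eventually.of_forall fun t _ => (Real.hasSum_cosh |x|).summable
    · exact intervalIntegrable_const
    · exact Filter.Eventually.of_forall fun t _ => (Real.hasSum_cos (x * t)).mul_left _
  have hterm : ∀ m : ℕ, ∫ t in (-1 : ℝ)..1, (1 - t ^ 2) ^ a *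
      ((-1) ^ m * (x * t) ^ (2 * m) / ((2 * m).factorial : ℝ)) =
      c 0 * Real.Gamma (ν + 1) * (besselCoeff ν m * ((x / 2) ^ 2) ^ m) := fun m => by
    have e : ∀ t : ℝ, (1 - t ^ 2) ^ a * ((-1) ^ m * (x * t) ^ (2 * m) / ((2 * m).factorial : ℝ)) =
        ((-1) ^ m * x ^ (2 * m) / ((2 * m).factorial : ℝ)) * ((1 - t ^ 2) ^ a * t ^ (2 * m)) :=
      fun t => by rw [mul_pow]; ring
    simp_rw [e]
    rw [intervalIntegral.integral_const_mul]
    change _ * c m = _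
    have h := hcm m
    have e2 : ((x / 2) ^ 2) ^ m = x ^ (2 * m) / 4 ^ m := by
      rw [div_pow, div_pow, pow_mul]; norm_num
    rw [e2, besselCoeff]
    calc (-1) ^ m * x ^ (2 * m) / ((2 * m).factorial : ℝ) * c m
        = (-1) ^ m * x ^ (2 * m) * (c m / ((2 * m).factorial : ℝ)) := by ring
      _ = _ := by rw [h]; field_simp
  simp_rw [hterm] at hsum
  exact hsum.unique ((hasSum_besselPhi (by linarith) _).mul_left _)

/-! ### Asymptotics along the real axis -/

/-- `(1 - z²)^a e^{ixz}` on the half strip `|Re z| ≤ 1`, `Im z ≥ 0`, with the branch that is real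
on `(-1, 1)`. -/
def poissonKernel (a x : ℝ) (z : ℂ) : ℂ :=
  (1 - z) ^ (a : ℂ) * (1 + z) ^ (a : ℂ) * Complex.exp (Complex.I * x * z)

theorem continuousOn_poissonKernel {a : ℝ} (ha : 0 < a) (x : ℝ) :
    ContinuousOn (poissonKernel a x) {z | -1 ≤ z.re ∧ z.re ≤ 1} := by
  intro z hz
  apply ContinuousAt.continuousWithinAt
  have h1 : ContinuousAt (fun z : ℂ => (1 - z) ^ (a : ℂ)) z :=
    (Complex.continuousAt_cpow_const_of_re_pos (z := 1 - z) (w := (a : ℂ))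
      (Or.inl (by simpa using hz.2)) (by simpa using ha)).comp (f := fun z : ℂ => 1 - z)
      (by fun_prop)
  have h2 : ContinuousAt (fun z : ℂ => (1 + z) ^ (a : ℂ)) z :=
    (Complex.continuousAt_cpow_const_of_re_pos (z := 1 + z) (w := (a : ℂ))
      (Or.inl (by simp; linarith [hz.1])) (by simpa using ha)).comp (f := fun z : ℂ => 1 + z)
      (by fun_prop)
  exact (h1.mul h2).mul (by fun_prop)

theorem differentiableAt_poissonKernel (a x : ℝ) {z : ℂ} (hz : -1 < z.re) (hz' : z.re < 1) :
    DifferentiableAt ℂ (poissonKernel a x) z := by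
  have h1 : DifferentiableAt ℂ (fun z : ℂ => (1 - z) ^ (a : ℂ)) z :=
    (((hasDerivAt_id z).const_sub 1).cpow_const
      (Or.inl (by simpa using hz'))).differentiableAt
  have h2 : DifferentiableAt ℂ (fun z : ℂ => (1 + z) ^ (a : ℂ)) z :=
    (((hasDerivAt_id z).const_add 1).cpow_const
      (Or.inl (by simp; linarith))).differentiableAt
  exact (h1.mul h2).mul (by fun_prop)

theorem conj_cpow_ofReal {z : ℂ} (hz : 0 ≤ z.re) (a : ℝ) :
    (starRingEnd ℂ z) ^ (a : ℂ) = starRingEnd ℂ (z ^ (a : ℂ)) := by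
  rw [Complex.conj_cpow _ _ (by rw [ne_eq, Complex.arg_eq_pi_iff]; intro h; linarith [h.1]),
    Complex.conj_ofReal]

/-- The two vertical edges of the half strip are conjugate to each other. -/
theorem poissonKernel_left (a x : ℝ) (y : ℝ) :
    poissonKernel a x (-1 + y * Complex.I) =
      starRingEnd ℂ (poissonKernel a x (1 + y * Complex.I)) := by
  have e1 : (1 : ℂ) - (-1 + y * Complex.I) = starRingEnd ℂ (1 + (1 + y * Complex.I)) := by
    simp only [map_add, map_mul, map_one, Complex.conj_I, Complex.conj_ofReal]; ring
  have e2 : (1 : ℂ) + (-1 + y * Complex.I) = starRingEnd ℂ (1 - (1 + y * Complex.I)) := by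
    simp only [map_sub, map_add, map_mul, map_one, Complex.conj_I, Complex.conj_ofReal]; ring
  have e3 : Complex.I * x * (-1 + y * Complex.I) =
      starRingEnd ℂ (Complex.I * x * (1 + y * Complex.I)) := by
    simp only [map_add, map_mul, map_one, Complex.conj_I, Complex.conj_ofReal]; ring
  unfold poissonKernel
  rw [e1, e2, e3, conj_cpow_ofReal (by simp), conj_cpow_ofReal (by simp), Complex.exp_conj,
    map_mul, map_mul]
  ring

theorem poissonKernel_right (a x : ℝ) {y : ℝ} (hy : 0 < y) :
    poissonKernel a x (1 + y * Complex.I) =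
      Complex.exp (Complex.I * ((x - Real.pi / 2 * a : ℝ) : ℂ)) *
        ((y ^ a * Real.exp (-(x * y)) : ℝ) : ℂ) * (2 + y * Complex.I) ^ (a : ℂ) := by
  have hyc : (y : ℂ) ≠ 0 := by exact_mod_cast hy.ne'
  have e1 : (1 : ℂ) - (1 + y * Complex.I) = y * (-Complex.I) := by ring
  have hne : (y : ℂ) * (-Complex.I) ≠ 0 := mul_ne_zero hyc (neg_ne_zero.mpr Complex.I_ne_zero)
  have e2 : (1 : ℂ) + (1 + y * Complex.I) = 2 + y * Complex.I := by ring
  have e3 : ((y : ℂ) * (-Complex.I)) ^ (a : ℂ) =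
      ((y ^ a : ℝ) : ℂ) * Complex.exp (-(Real.pi / 2 * a : ℂ) * Complex.I) := by
    rw [Complex.cpow_def_of_ne_zero hne, Complex.log_ofReal_mul hy (neg_ne_zero.mpr
      Complex.I_ne_zero), Complex.log_neg_I, Complex.ofReal_cpow hy.le,
      Complex.cpow_def_of_ne_zero hyc, ← Complex.exp_add, ← Complex.ofReal_log hy.le]
    congr 1
    ring
  unfold poissonKernel
  rw [e1, e2, e3]
  have e4 : Complex.exp (Complex.I * x * (1 + y * Complex.I)) =
      Complex.exp (Complex.I * x) * ((Real.exp (-(x * y)) : ℝ) : ℂ) := by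
    rw [Complex.ofReal_exp, ← Complex.exp_add]
    congr 1
    push_cast
    linear_combination (x * y : ℂ) * Complex.I_mul_I
  have e5 : Complex.exp (Complex.I * ((x - Real.pi / 2 * a : ℝ) : ℂ)) =
      Complex.exp (-(Real.pi / 2 * a : ℂ) * Complex.I) * Complex.exp (Complex.I * x) := by
    rw [← Complex.exp_add]
    congr 1
    push_cast
    ring
  rw [e4, e5]
  push_cast
  ring

theorem re_poissonKernel_ofReal (a x : ℝ) {t : ℝ} (h1 : -1 ≤ t) (h2 : t ≤ 1) :
    (poissonKernel a x t).re = (1 - t ^ 2) ^ a * Real.cos (x * t) := by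
  have e1 : (1 - (t : ℂ)) ^ (a : ℂ) * (1 + (t : ℂ)) ^ (a : ℂ) = (((1 - t ^ 2) ^ a : ℝ) : ℂ) := by
    have h3 : (1 : ℂ) - t = ((1 - t : ℝ) : ℂ) := by push_cast; ring
    have h4 : (1 : ℂ) + t = ((1 + t : ℝ) : ℂ) := by push_cast; ring
    rw [h3, h4, ← Complex.ofReal_cpow (by linarith), ← Complex.ofReal_cpow (by linarith),
      ← Complex.ofReal_mul, ← Real.mul_rpow (by linarith) (by linarith)]
    congr 2
    ring
  have e2 : Complex.I * x * t = ((x * t : ℝ) : ℂ) * Complex.I := by push_cast; ring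
  unfold poissonKernel
  rw [e1, e2, Complex.re_ofReal_mul, Complex.exp_ofReal_mul_I_re]

/-- Cauchy's theorem for the rectangle with vertices `±1`, `±1 + iR`. -/
theorem integral_cos_eq_contour {a : ℝ} (ha : 0 < a) (x : ℝ) {R : ℝ} (hR : 0 ≤ R) :
    ∫ t in (-1 : ℝ)..1, (1 - t ^ 2) ^ a * Real.cos (x * t) =
      (∫ t in (-1 : ℝ)..1, poissonKernel a x (t + R * Complex.I)).re +
        2 * (∫ y in (0 : ℝ)..R, poissonKernel a x (1 + y * Complex.I)).im := by
  have hcauchy := Complex.integral_boundary_rect_eq_zero_of_continuousOn_of_differentiableOn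
    (poissonKernel a x) (-1) (1 + R * Complex.I)
    ((continuousOn_poissonKernel ha x).mono fun z hz => by
      have := hz.1
      simp only [Complex.neg_re, Complex.one_re, Complex.add_re, Complex.mul_re, Complex.ofReal_re,
        Complex.I_re, mul_zero, Complex.ofReal_im, Complex.I_im, mul_one, sub_zero, add_zero,
        Set.mem_preimage] at this
      rw [Set.uIcc_of_le (by norm_num)] at this
      exact this)
    (fun z hz => by
      have := hz.1
      simp only [Complex.neg_re, Complex.one_re, Complex.add_re, Complex.mul_re, Complex.ofReal_re,
        Complex.I_re, mul_zero, Complex.ofReal_im, Complex.I_im, mul_one, sub_zero, add_zero,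
        Set.mem_preimage] at this
      norm_num at this
      exact (differentiableAt_poissonKernel a x this.1 this.2).differentiableWithinAt)
  simp only [Complex.neg_re, Complex.one_re, Complex.add_re, Complex.mul_re, Complex.ofReal_re,
    Complex.I_re, mul_zero, Complex.ofReal_im, Complex.I_im, mul_one, sub_zero, add_zero,
    Complex.neg_im, Complex.one_im, neg_zero, Complex.ofReal_zero, zero_mul, Complex.add_im,
    Complex.mul_im, zero_add, Complex.ofReal_neg, Complex.ofReal_one, smul_eq_mul,
    poissonKernel_left] at hcauchy
  have hconj : ∫ y in (0 : ℝ)..R, starRingEnd ℂ (poissonKernel a x (1 + y * Complex.I)) =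
      starRingEnd ℂ (∫ y in (0 : ℝ)..R, poissonKernel a x (1 + y * Complex.I)) := by
    rw [intervalIntegral.integral_of_le hR, intervalIntegral.integral_of_le hR, integral_conj]
  have hint : IntervalIntegrable (fun t : ℝ => poissonKernel a x t) volume (-1) 1 := by
    refine ContinuousOn.intervalIntegrable ?_
    refine (continuousOn_poissonKernel ha x).comp Complex.continuous_ofReal.continuousOn
      fun t ht => ?_
    rw [Set.uIcc_of_le (by norm_num)] at ht
    exact ht
  have hre : ∫ t in (-1 : ℝ)..1, (1 - t ^ 2) ^ a * Real.cos (x * t) =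
      (∫ t in (-1 : ℝ)..1, poissonKernel a x t).re := by
    have h := Complex.reCLM.intervalIntegral_comp_comm hint
    rw [Complex.reCLM_apply] at h
    rw [← h]
    refine intervalIntegral.integral_congr fun t ht => ?_
    rw [Set.uIcc_of_le (by norm_num)] at ht
    exact (re_poissonKernel_ofReal a x ht.1 ht.2).symm
  rw [hconj] at hcauchy
  have h := congrArg Complex.re hcauchy
  simp only [Complex.sub_re, Complex.add_re, Complex.mul_re, Complex.I_re, Complex.I_im, zero_mul,
    one_mul, Complex.conj_im, Complex.zero_re, zero_sub] at h
  rw [hre]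
  linarith

/-- The factor `(2 + y)^a` costs at most half of the decay `e^{-y}`. -/
theorem exists_rpow_le_exp (a : ℝ) (ha : 0 < a) :
    ∃ K : ℝ, 0 < K ∧ ∀ y : ℝ, 0 ≤ y → (2 + y) ^ a ≤ K * Real.exp (y / 2) := by
  refine ⟨Real.exp (1 - a + a * Real.log (2 * a)), Real.exp_pos _, fun y hy => ?_⟩
  have h2 : 0 < 2 + y := by linarith
  rw [Real.rpow_def_of_pos h2, ← Real.exp_add]
  refine Real.exp_le_exp.mpr ?_
  have h := Real.log_le_sub_one_of_pos (x := (2 + y) / (2 * a)) (by positivity)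
  rw [Real.log_div h2.ne' (by positivity)] at h
  have h3 := mul_le_mul_of_nonneg_left h ha.le
  have e : a * ((2 + y) / (2 * a) - 1) = (2 + y) / 2 - a := by field_simp
  rw [e] at h3
  linarith

theorem norm_two_add_mul_I_le {y : ℝ} (hy : 0 ≤ y) : ‖(2 : ℂ) + y * Complex.I‖ ≤ 2 + y := by
  refine (norm_add_le _ _).trans ?_
  simp [abs_of_nonneg hy]

theorem norm_cpow_sub_two_cpow_le {a : ℝ} (ha : 0 < a) {y : ℝ} (hy : 0 ≤ y) :
    ‖(2 + y * Complex.I) ^ (a : ℂ) - ((2 ^ a : ℝ) : ℂ)‖ ≤ a * (2 + y) ^ a * y := by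
  have hd : ∀ s ∈ Set.Icc 0 y, HasDerivWithinAt (fun s : ℝ => (2 + s * Complex.I) ^ (a : ℂ))
      ((a : ℂ) * (2 + s * Complex.I) ^ ((a : ℂ) - 1) * Complex.I) (Set.Icc 0 y) s := fun s hs => by
    have h1 : HasDerivAt (fun z : ℂ => 2 + z * Complex.I) Complex.I (s : ℂ) := by
      simpa using ((hasDerivAt_id (s : ℂ)).mul_const Complex.I).const_add 2
    exact (h1.cpow_const (c := (a : ℂ)) (Or.inl (by simp))).comp_ofReal.hasDerivWithinAt
  have hb : ∀ s ∈ Set.Ico 0 y,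
      ‖(a : ℂ) * (2 + s * Complex.I) ^ ((a : ℂ) - 1) * Complex.I‖ ≤ a * (2 + y) ^ a :=
    fun s hs => by
    have e : (a : ℂ) - 1 = ((a - 1 : ℝ) : ℂ) := by push_cast; ring
    have h2 : 2 ≤ ‖(2 : ℂ) + s * Complex.I‖ := by
      have := Complex.abs_re_le_norm ((2 : ℂ) + s * Complex.I)
      simpa using this
    have h3 := (norm_two_add_mul_I_le hs.1).trans (by linarith [hs.2] : 2 + s ≤ 2 + y)
    rw [norm_mul, norm_mul, Complex.norm_I, mul_one, e, Complex.norm_cpow_real, Complex.norm_real,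
      Real.norm_of_nonneg ha.le]
    gcongr
    calc ‖(2 : ℂ) + s * Complex.I‖ ^ (a - 1) ≤ ‖(2 : ℂ) + s * Complex.I‖ ^ a :=
          Real.rpow_le_rpow_of_exponent_le (by linarith) (by linarith)
      _ ≤ (2 + y) ^ a := Real.rpow_le_rpow (norm_nonneg _) h3 ha.le
  have h := norm_image_sub_le_of_norm_deriv_le_segment' hd hb y ⟨hy, le_rfl⟩
  have e : ((2 : ℂ) + ((0 : ℝ) : ℂ) * Complex.I) ^ (a : ℂ) = ((2 ^ a : ℝ) : ℂ) := by
    rw [Complex.ofReal_cpow (by norm_num)]; simp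
  rw [e, sub_zero] at h
  exact h

theorem integrableOn_rpow_mul_exp {s b : ℝ} (hs : 0 < s) (hb : 0 < b) :
    IntegrableOn (fun y : ℝ => y ^ s * Real.exp (-(b * y))) (Set.Ioi 0) := by
  have h := integrableOn_rpow_mul_exp_neg_mul_rpow (p := 1) (s := s) (b := b) (by linarith)
    one_pos hb
  simpa using h

theorem integral_rpow_mul_exp {s b : ℝ} (hs : 0 < s) (hb : 0 < b) :
    ∫ y in Set.Ioi (0 : ℝ), y ^ s * Real.exp (-(b * y)) = Real.Gamma (s + 1) / b ^ (s + 1) := by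
  have h := Real.integral_rpow_mul_exp_neg_mul_Ioi (a := s + 1) (by linarith) hb
  rw [add_sub_cancel_right] at h
  rw [h, Real.div_rpow zero_le_one hb.le, Real.one_rpow]
  ring

theorem norm_poissonKernel_top_le {a K : ℝ} (ha : 0 < a)
    (hK : ∀ y : ℝ, 0 ≤ y → (2 + y) ^ a ≤ K * Real.exp (y / 2)) {x R t : ℝ} (hx : 2 ≤ x)
    (hR : 0 ≤ R) (h1 : -1 ≤ t) (h2 : t ≤ 1) :
    ‖poissonKernel a x (t + R * Complex.I)‖ ≤ K ^ 2 * Real.exp (-R) := by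
  have hn1 : ‖(1 : ℂ) - (t + R * Complex.I)‖ ≤ 2 + R := by
    have e : (1 : ℂ) - (t + R * Complex.I) = ((1 - t : ℝ) : ℂ) - R * Complex.I := by
      push_cast; ring
    rw [e]
    refine (norm_sub_le _ _).trans ?_
    rw [Complex.norm_real, norm_mul, Complex.norm_I, Complex.norm_real, mul_one,
      Real.norm_of_nonneg hR, Real.norm_of_nonneg (by linarith)]
    linarith
  have hn2 : ‖(1 : ℂ) + (t + R * Complex.I)‖ ≤ 2 + R := by
    have e : (1 : ℂ) + (t + R * Complex.I) = ((1 + t : ℝ) : ℂ) + R * Complex.I := by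
      push_cast; ring
    rw [e]
    refine (norm_add_le _ _).trans ?_
    rw [Complex.norm_real, norm_mul, Complex.norm_I, Complex.norm_real, mul_one,
      Real.norm_of_nonneg hR, Real.norm_of_nonneg (by linarith)]
    linarith
  have hexp : ‖Complex.exp (Complex.I * x * (t + R * Complex.I))‖ = Real.exp (-(x * R)) := by
    rw [Complex.norm_exp]
    simp
  have hc1 : ‖(1 : ℂ) - (t + R * Complex.I)‖ ^ a ≤ K * Real.exp (R / 2) :=
    (Real.rpow_le_rpow (norm_nonneg _) hn1 ha.le).trans (hK R hR)
  have hc2 : ‖(1 : ℂ) + (t + R * Complex.I)‖ ^ a ≤ K * Real.exp (R / 2) :=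
    (Real.rpow_le_rpow (norm_nonneg _) hn2 ha.le).trans (hK R hR)
  unfold poissonKernel
  rw [norm_mul, norm_mul, Complex.norm_cpow_real, Complex.norm_cpow_real, hexp]
  calc ‖(1 : ℂ) - (t + R * Complex.I)‖ ^ a * ‖(1 : ℂ) + (t + R * Complex.I)‖ ^ a *
        Real.exp (-(x * R))
      ≤ (K * Real.exp (R / 2)) * (K * Real.exp (R / 2)) * Real.exp (-(2 * R)) := by
        have h0 : 0 ≤ K * Real.exp (R / 2) := (by positivity : (0:ℝ) ≤ _).trans hc1
        gcongr
    _ = K ^ 2 * (Real.exp (R / 2) * Real.exp (R / 2) * Real.exp (-(2 * R))) := by ring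
    _ = K ^ 2 * Real.exp (-R) := by
        rw [← Real.exp_add, ← Real.exp_add]
        congr 2
        ring

/-- The contribution of the right edge of the contour, up to an error one power of `x` smaller. -/
theorem norm_integral_poissonKernel_right_sub_le {a K : ℝ} (ha : 0 < a)
    (hK0 : 0 < K) (hK : ∀ y : ℝ, 0 ≤ y → (2 + y) ^ a ≤ K * Real.exp (y / 2)) {x R : ℝ} (hx : 2 ≤ x)
    (hR : 0 ≤ R) :
    ‖(∫ y in (0 : ℝ)..R, poissonKernel a x (1 + y * Complex.I)) -
      Complex.exp (Complex.I * ((x - Real.pi / 2 * a : ℝ) : ℂ)) *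
        ((2 ^ a * ∫ y in (0 : ℝ)..R, y ^ a * Real.exp (-(x * y)) : ℝ) : ℂ)‖ ≤
      a * K * (Real.Gamma (a + 2) / (x / 2) ^ (a + 2)) := by
  set E := Complex.exp (Complex.I * ((x - Real.pi / 2 * a : ℝ) : ℂ)) with hE
  have hEn : ‖E‖ = 1 := Complex.norm_exp_I_mul_ofReal _
  have hi1 : IntervalIntegrable (fun y : ℝ => poissonKernel a x (1 + y * Complex.I))
      volume 0 R := by
    refine ContinuousOn.intervalIntegrable ?_
    refine (continuousOn_poissonKernel ha x).comp (by fun_prop) fun y hy => ?_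
    simp
  have hc : Continuous fun y : ℝ => y ^ a * Real.exp (-(x * y)) := by
    have : Continuous fun y : ℝ => y ^ a := Real.continuous_rpow_const ha.le
    fun_prop
  have e1 : E * ((2 ^ a * ∫ y in (0 : ℝ)..R, y ^ a * Real.exp (-(x * y)) : ℝ) : ℂ) =
      ∫ y in (0 : ℝ)..R, E * (((2 ^ a : ℝ) : ℂ) * ((y ^ a * Real.exp (-(x * y)) : ℝ) : ℂ)) := by
    rw [intervalIntegral.integral_const_mul, intervalIntegral.integral_const_mul,
      intervalIntegral.integral_ofReal, Complex.ofReal_mul]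
  have hi2 : IntervalIntegrable (fun y : ℝ =>
      E * (((2 ^ a : ℝ) : ℂ) * ((y ^ a * Real.exp (-(x * y)) : ℝ) : ℂ))) volume 0 R :=
    Continuous.intervalIntegrable (by fun_prop) _ _
  have hint := integrableOn_rpow_mul_exp (s := a + 1) (b := x / 2) (by linarith) (by linarith)
  have hval := integral_rpow_mul_exp (s := a + 1) (b := x / 2) (by linarith) (by linarith)
  rw [show a + 1 + 1 = a + 2 by ring] at hval
  rw [e1, ← intervalIntegral.integral_sub hi1 hi2]
  have hii : IntervalIntegrable
      (fun y : ℝ => a * K * (y ^ (a + 1) * Real.exp (-(x / 2 * y)))) volume 0 R := by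
    rw [intervalIntegrable_iff_integrableOn_Ioc_of_le hR]
    exact (hint.mono_set Set.Ioc_subset_Ioi_self).const_mul _
  refine (intervalIntegral.norm_integral_le_of_norm_le hR ?_ hii).trans ?_
  · refine Eventually.of_forall fun y hy => ?_
    have hy0 : 0 < y := hy.1
    have hya : 0 ≤ y ^ a := Real.rpow_nonneg hy0.le a
    rw [poissonKernel_right a x hy0]
    have e2 : E * ((y ^ a * Real.exp (-(x * y)) : ℝ) : ℂ) * (2 + y * Complex.I) ^ (a : ℂ) -
        E * (((2 ^ a : ℝ) : ℂ) * ((y ^ a * Real.exp (-(x * y)) : ℝ) : ℂ)) =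
        E * ((y ^ a * Real.exp (-(x * y)) : ℝ) : ℂ) *
          ((2 + y * Complex.I) ^ (a : ℂ) - ((2 ^ a : ℝ) : ℂ)) := by ring
    rw [e2, norm_mul, norm_mul, hEn, one_mul, Complex.norm_real, Real.norm_of_nonneg
      (mul_nonneg hya (Real.exp_pos _).le)]
    calc y ^ a * Real.exp (-(x * y)) * ‖(2 + y * Complex.I) ^ (a : ℂ) - ((2 ^ a : ℝ) : ℂ)‖
        ≤ y ^ a * Real.exp (-(x * y)) * (a * (K * Real.exp (y / 2)) * y) := by
          gcongr
          refine (norm_cpow_sub_two_cpow_le ha hy0.le).trans ?_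
          gcongr
          exact hK y hy0.le
      _ = a * K * (y ^ a * y * (Real.exp (-(x * y)) * Real.exp (y / 2))) := by ring
      _ ≤ a * K * (y ^ (a + 1) * Real.exp (-(x / 2 * y))) := by
          rw [← Real.exp_add, Real.rpow_add_one hy0.ne']
          gcongr
          nlinarith
  · rw [intervalIntegral.integral_const_mul, intervalIntegral.integral_of_le hR, ← hval]
    gcongr
    · filter_upwards [ae_restrict_mem measurableSet_Ioi] with y hy
      have : (0 : ℝ) < y := hy
      simp only [Pi.zero_apply]
      positivity
    · exact Set.Ioc_subset_Ioi_self

theorem exists_abs_integral_cos_sub_le {a : ℝ} (ha : 0 < a) :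
    ∃ D : ℝ, 0 ≤ D ∧ ∀ x : ℝ, 2 ≤ x →
      |(∫ t in (-1 : ℝ)..1, (1 - t ^ 2) ^ a * Real.cos (x * t)) -
        2 * 2 ^ a * Real.Gamma (a + 1) / x ^ (a + 1) * Real.sin (x - Real.pi / 2 * a)| ≤
        D / x ^ (a + 2) := by
  obtain ⟨K, hK0, hK⟩ := exists_rpow_le_exp a ha
  have hG2 : 0 < Real.Gamma (a + 2) := Real.Gamma_pos_of_pos (by linarith)
  refine ⟨2 * (a * K * Real.Gamma (a + 2) * 2 ^ (a + 2)), by positivity, fun x hx => ?_⟩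
  have hx0 : 0 < x := by linarith
  set A := ∫ t in (-1 : ℝ)..1, (1 - t ^ 2) ^ a * Real.cos (x * t) with hA
  have hfin : ∀ R : ℝ, 0 ≤ R →
      |A - 2 * (Real.sin (x - Real.pi / 2 * a) *
        (2 ^ a * ∫ y in (0 : ℝ)..R, y ^ a * Real.exp (-(x * y))))| ≤
      2 * (a * K * Real.Gamma (a + 2) * 2 ^ (a + 2)) / x ^ (a + 2) +
        2 * (K ^ 2 * Real.exp (-R)) := fun R hR => by
    rw [hA, integral_cos_eq_contour ha x hR]
    set Z := ∫ y in (0 : ℝ)..R, poissonKernel a x (1 + y * Complex.I)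
    set t := ∫ t in (-1 : ℝ)..1, poissonKernel a x (t + R * Complex.I)
    set J := 2 ^ a * ∫ y in (0 : ℝ)..R, y ^ a * Real.exp (-(x * y))
    have h1 : |t.re| ≤ 2 * (K ^ 2 * Real.exp (-R)) := by
      refine (Complex.abs_re_le_norm t).trans ?_
      have := intervalIntegral.norm_integral_le_of_norm_le_const (a := (-1 : ℝ)) (b := 1)
        (f := fun t : ℝ => poissonKernel a x (t + R * Complex.I)) (C := K ^ 2 * Real.exp (-R))
        (fun s hs => by
          rw [Set.uIoc_of_le (by norm_num)] at hs
          exact norm_poissonKernel_top_le ha hK hx hR hs.1.le hs.2)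
      refine this.trans_eq ?_
      norm_num
      ring
    have h2 := norm_integral_poissonKernel_right_sub_le ha hK0 hK hx hR
    have h3 : |Z.im - Real.sin (x - Real.pi / 2 * a) * J| ≤
        a * K * (Real.Gamma (a + 2) / (x / 2) ^ (a + 2)) := by
      refine le_trans ?_ h2
      refine le_trans (le_of_eq ?_) (Complex.abs_im_le_norm _)
      rw [Complex.sub_im, Complex.im_mul_ofReal, mul_comm Complex.I, Complex.exp_ofReal_mul_I_im]
    have h4 : a * K * (Real.Gamma (a + 2) / (x / 2) ^ (a + 2)) =
        a * K * Real.Gamma (a + 2) * 2 ^ (a + 2) / x ^ (a + 2) := by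
      rw [Real.div_rpow hx0.le (by norm_num)]
      field_simp
    rw [h4] at h3
    calc |t.re + 2 * Z.im - 2 * (Real.sin (x - Real.pi / 2 * a) * J)|
        = |2 * (Z.im - Real.sin (x - Real.pi / 2 * a) * J) + t.re| := by congr 1; ring
      _ ≤ |2 * (Z.im - Real.sin (x - Real.pi / 2 * a) * J)| + |t.re| := abs_add_le _ _
      _ ≤ 2 * (a * K * Real.Gamma (a + 2) * 2 ^ (a + 2) / x ^ (a + 2)) +
          2 * (K ^ 2 * Real.exp (-R)) := by
          rw [abs_mul, abs_two]
          gcongr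
      _ = _ := by ring
  have hlim1 : Tendsto (fun R : ℝ => ∫ y in (0 : ℝ)..R, y ^ a * Real.exp (-(x * y))) atTop
      (𝓝 (Real.Gamma (a + 1) / x ^ (a + 1))) := by
    rw [← integral_rpow_mul_exp ha hx0]
    exact intervalIntegral_tendsto_integral_Ioi 0 (integrableOn_rpow_mul_exp ha hx0) tendsto_id
  have hlim2 : Tendsto (fun R : ℝ => Real.exp (-R)) atTop (𝓝 0) :=
    Real.tendsto_exp_neg_atTop_nhds_zero
  have hL := ((((hlim1.const_mul (2 ^ a)).const_mul (Real.sin (x - Real.pi / 2 * a))).const_mul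
    2).const_sub A).abs
  have hRt := ((hlim2.const_mul (K ^ 2)).const_mul 2).const_add
    (2 * (a * K * Real.Gamma (a + 2) * 2 ^ (a + 2)) / x ^ (a + 2))
  have hle := le_of_tendsto_of_tendsto hL hRt (by
    filter_upwards [eventually_ge_atTop 0] with R hR using hfin R hR)
  rw [mul_zero, mul_zero, add_zero] at hle
  convert! hle using 2
  ring

/-- `√x J_ν(x)` is a multiple of `cos (x - νπ/2 - π/4) + O(1/x)`. -/
theorem exists_abs_besselU_sub_le {ν : ℝ} (hν : 1 / 2 < ν) :
    ∃ C D : ℝ, 0 < C ∧ 0 ≤ D ∧ ∀ x : ℝ, 2 ≤ x →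
      |besselU ν x - C * Real.cos (x - (ν * Real.pi / 2 + Real.pi / 4))| ≤ D / x := by
  have ha : 0 < ν - 1 / 2 := by linarith
  obtain ⟨K, hK, hpoisson⟩ := exists_poisson_integral hν
  obtain ⟨D, hD, hasym⟩ := exists_abs_integral_cos_sub_le ha
  have hG : 0 < Real.Gamma (ν - 1 / 2 + 1) := Real.Gamma_pos_of_pos (by linarith)
  refine ⟨2 * 2 ^ (ν - 1 / 2) * Real.Gamma (ν - 1 / 2 + 1) / K, D / K, by positivity,
    by positivity, fun x hx => ?_⟩
  have hx0 : 0 < x := by linarith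
  have h := hasym x hx
  rw [hpoisson] at h
  have hp : 0 < x ^ (ν - 1 / 2 + 1) := Real.rpow_pos_of_pos hx0 _
  have e1 : x ^ (ν - 1 / 2 + 2) = x ^ (ν - 1 / 2 + 1) * x := by
    rw [← Real.rpow_add_one hx0.ne']; congr 1; ring
  have e2 : Real.sin (x - Real.pi / 2 * (ν - 1 / 2)) =
      Real.cos (x - (ν * Real.pi / 2 + Real.pi / 4)) := by
    rw [← Real.cos_sub_pi_div_two]; congr 1; ring
  have e3 : besselU ν x = x ^ (ν - 1 / 2 + 1) * besselG ν x := by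
    rw [besselU]; congr 2; ring
  rw [e1, e2] at h
  set c := Real.cos (x - (ν * Real.pi / 2 + Real.pi / 4))
  set g := Real.Gamma (ν - 1 / 2 + 1)
  have e4 : besselU ν x - 2 * 2 ^ (ν - 1 / 2) * g / K * c = x ^ (ν - 1 / 2 + 1) / K *
      (K * besselG ν x - 2 * 2 ^ (ν - 1 / 2) * g / x ^ (ν - 1 / 2 + 1) * c) := by
    rw [e3]
    field_simp
  rw [e4, abs_mul, abs_of_pos (by positivity)]
  calc x ^ (ν - 1 / 2 + 1) / K * _
      ≤ x ^ (ν - 1 / 2 + 1) / K * (D / (x ^ (ν - 1 / 2 + 1) * x)) := by gcongr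
    _ = D / K / x := by field_simp

/-! ### Asymptotics of the zeros -/

theorem abs_cos_add_int_mul_pi (x : ℝ) (m : ℤ) : |Real.cos (x + m * Real.pi)| = |Real.cos x| := by
  rw [Real.cos_add_int_mul_pi, abs_mul, abs_zpow, abs_neg, abs_one, one_zpow, one_mul]

/-- Where the error term is dominated, `√x J_ν(x)` changes sign between consecutive extrema of the
cosine. -/
theorem exists_besselG_zero_Ioo_of_lt {ν C D : ℝ} (hν : 1 / 2 < ν)
    (h : ∀ x : ℝ, 2 ≤ x →
      |besselU ν x - C * Real.cos (x - (ν * Real.pi / 2 + Real.pi / 4))| ≤ D / x)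
    {j : ℤ} (h2 : 2 ≤ ν * Real.pi / 2 + Real.pi / 4 + j * Real.pi) (hD : 0 ≤ D)
    (hlt : D / (ν * Real.pi / 2 + Real.pi / 4 + j * Real.pi) < C) :
    ∃ x ∈ Set.Ioo (ν * Real.pi / 2 + Real.pi / 4 + j * Real.pi)
      (ν * Real.pi / 2 + Real.pi / 4 + (j + 1) * Real.pi), besselG ν x = 0 := by
  set φ := ν * Real.pi / 2 + Real.pi / 4 with hφ
  have hpi := Real.pi_pos
  set y := φ + j * Real.pi with hy
  have hy' : φ + (j + 1) * Real.pi = y + Real.pi := by rw [hy]; ring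
  rw [hy']
  set s : ℝ := (-1 : ℝ) ^ j with hs
  have hs1 : |s| = 1 := by rw [hs, abs_zpow, abs_neg, abs_one, one_zpow]
  have hss : s * s = 1 := by rw [← abs_mul_abs_self, hs1, one_mul]
  have hc1 : Real.cos (y - φ) = s := by
    rw [hy, add_sub_cancel_left, Real.cos_int_mul_pi]
  have hc2 : Real.cos (y + Real.pi - φ) = -s := by
    rw [show y + Real.pi - φ = (y - φ) + Real.pi by ring, Real.cos_add_pi, hc1]
  have key : ∀ x r : ℝ, y ≤ x → Real.cos (x - φ) = r * s → |s * besselU ν x - r * C| < C :=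
    fun x r hx hr => by
      have h1 := h x (h2.trans hx)
      have h3 : D / x ≤ D / y := by gcongr
      rw [hr] at h1
      have e : s * besselU ν x - r * C = s * (besselU ν x - C * (r * s)) := by
        linear_combination (r * C) * hss
      rw [e, abs_mul, hs1, one_mul]
      linarith
  have hpos : 0 < s * besselU ν y := by
    have := abs_lt.mp (key y 1 le_rfl (by rw [hc1, one_mul]))
    linarith [this.1]
  have hneg : s * besselU ν (y + Real.pi) < 0 := by
    have := abs_lt.mp (key (y + Real.pi) (-1) (by linarith) (by rw [hc2]; ring))
    linarith [this.2]
  have hcont : ContinuousOn (fun x => s * besselU ν x) (Set.Icc y (y + Real.pi)) := fun x hx =>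
    ((hasDerivAt_besselU (ν := ν) (by linarith)
      (by linarith [hx.1])).continuousAt.const_mul s).continuousWithinAt
  obtain ⟨x, hx, hx0⟩ := intermediate_value_Ioo' (by linarith : y ≤ y + Real.pi) hcont
    (show (0 : ℝ) ∈ _ from ⟨hneg, hpos⟩)
  have hs0 : s ≠ 0 := fun h0 => by rw [h0, zero_mul] at hss; exact zero_ne_one hss
  have hx2 : besselU ν x = 0 := (mul_eq_zero.mp hx0).resolve_left hs0
  have hxp : 0 < x ^ (ν + 1 / 2) := Real.rpow_pos_of_pos (by linarith [hx.1]) _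
  exact ⟨x, hx, (mul_eq_zero.mp hx2).resolve_left hxp.ne'⟩

/-- Asymptotics of the zeros, up to a shift of the numbering. -/
theorem exists_besselZero_asymptotic_shift {ν : ℝ} (hν : 1 / 2 < ν) :
    ∃ (N : ℤ) (E : ℝ), ∀ᶠ n : ℕ in atTop,
      |besselZero ν n - (n + N + ν / 2 - 1 / 4) * Real.pi| ≤ E / n := by
  obtain ⟨C, D, hC, hD, hasym⟩ := exists_abs_besselU_sub_le hν
  have hpi := Real.pi_pos
  have hpi3 := Real.pi_gt_three
  have hν' : -(1 / 2) < ν := by linarith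
  set φ := ν * Real.pi / 2 + Real.pi / 4 with hφ
  set z := besselZero ν with hz
  have hzn : ∀ n : ℕ, (n : ℝ) ≤ z n := fun n =>
    le_trans (by nlinarith [(n.cast_nonneg : (0 : ℝ) ≤ n)]) (mul_pi_le_besselZero hν n)
  -- `m n` is the half-period of the cosine in which the `n`-th zero lies
  let m : ℕ → ℤ := fun n => round ((z n - φ) / Real.pi - 1 / 2)
  let d : ℕ → ℝ := fun n => z n - φ - Real.pi / 2 - m n * Real.pi
  have hzd : ∀ n, z n = φ + Real.pi / 2 + m n * Real.pi + d n := fun n => by simp only [d]; ring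
  have hd : ∀ n, |d n| ≤ Real.pi / 2 := fun n => by
    have h := abs_sub_round ((z n - φ) / Real.pi - 1 / 2)
    have e : d n = ((z n - φ) / Real.pi - 1 / 2 - m n) * Real.pi := by
      simp only [d]; field_simp
    rw [e, abs_mul, abs_of_pos hpi]
    calc _ ≤ 1 / 2 * Real.pi := by gcongr
      _ = Real.pi / 2 := by ring
  set E := Real.pi / 2 * (D / C) with hE
  have hdn : ∀ n : ℕ, 2 ≤ n → |d n| ≤ E / n := fun n hn => by
    have hn' : (2 : ℝ) ≤ n := by exact_mod_cast hn
    have hz2 : 2 ≤ z n := hn'.trans (hzn n)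
    have h := hasym (z n) hz2
    have hU : besselU ν (z n) = 0 := by
      rw [besselU, hz, besselG_besselZero hν' (by omega), mul_zero]
    rw [hU, zero_sub, abs_neg, abs_mul, abs_of_pos hC] at h
    have e : z n - φ = (d n + Real.pi / 2) + m n * Real.pi := by simp only [d]; ring
    rw [e, abs_cos_add_int_mul_pi, Real.cos_add_pi_div_two, abs_neg] at h
    have h1 := Real.mul_abs_le_abs_sin (hd n)
    have h2 : D / z n ≤ D / n := by
      have := hzn n
      gcongr
    have h3 : C * (2 / Real.pi * |d n|) ≤ D / n := (by gcongr : _ ≤ _).trans (h.trans h2)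
    calc |d n| = Real.pi / 2 / C * (C * (2 / Real.pi * |d n|)) := by field_simp
      _ ≤ Real.pi / 2 / C * (D / n) := by gcongr
      _ = E / n := by rw [hE]; ring
  -- consecutive zeros lie in consecutive half-periods
  have hstep : ∀ᶠ n : ℕ in atTop, m (n + 1) = m n + 1 := by
    filter_upwards [eventually_ge_atTop 2, eventually_gt_atTop ⌈E⌉₊,
      eventually_gt_atTop ⌈D / C⌉₊] with n hn hnE hnD
    have hn' : (2 : ℝ) ≤ n := by exact_mod_cast hn
    have hnE' : E < n := (Nat.le_ceil E).trans_lt (by exact_mod_cast hnE)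
    have hnD' : D / C < n := (Nat.le_ceil _).trans_lt (by exact_mod_cast hnD)
    have hE0 : 0 ≤ E := by positivity
    have hd1 : |d n| < 1 := (hdn n hn).trans_lt (by rw [div_lt_one (by linarith)]; exact hnE')
    have hd2 : |d (n + 1)| < 1 := (hdn (n + 1) (by omega)).trans_lt (by
      rw [div_lt_one (by positivity)]; push_cast; linarith)
    have hd1' := abs_lt.mp hd1
    have hd2' := abs_lt.mp hd2
    have hgap := besselZero_add_pi_le hν n
    change z n + Real.pi ≤ z (n + 1) at hgap
    rw [hzd n, hzd (n + 1)] at hgap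
    have hlow : (m n : ℝ) < m (n + 1) := by
      by_contra! hcon
      nlinarith
    have hy : z n < φ + ((m n + 1 : ℤ) : ℝ) * Real.pi := by
      rw [hzd n]; push_cast; linarith [hd1'.2]
    have hyn : (n : ℝ) < φ + ((m n + 1 : ℤ) : ℝ) * Real.pi := (hzn n).trans_lt hy
    obtain ⟨x, hx, hx0⟩ := exists_besselG_zero_Ioo_of_lt hν hasym (j := m n + 1)
      (by linarith) hD (by
        rw [div_lt_iff₀ (by linarith)]
        rw [div_lt_iff₀ hC] at hnD'
        calc D < n * C := hnD'
          _ ≤ C * (φ + ((m n + 1 : ℤ) : ℝ) * Real.pi) := by rw [mul_comm]; gcongr)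
    have hle : z (n + 1) ≤ x := besselZero_succ_le (hy.trans hx.1) hx0
    have hx2 := hx.2
    rw [hzd (n + 1)] at hle
    have hup : (m (n + 1) : ℝ) < m n + 2 := by
      by_contra! hcon
      push_cast at hx2
      nlinarith
    have h1 : m n < m (n + 1) := by exact_mod_cast hlow
    have h2 : m (n + 1) < m n + 2 := by exact_mod_cast hup
    omega
  obtain ⟨N₀, hN₀⟩ := eventually_atTop.mp hstep
  refine ⟨m N₀ - N₀ + 1, E, ?_⟩
  filter_upwards [eventually_ge_atTop N₀, eventually_ge_atTop 2] with n hn hn2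
  have hm : m n = m N₀ - N₀ + n := by
    clear hn2
    induction n, hn using Nat.le_induction with
    | base => ring
    | succ n hn ih => rw [hN₀ n hn, ih]; push_cast; ring
  have e : z n - (n + ((m N₀ - N₀ + 1 : ℤ) : ℝ) + ν / 2 - 1 / 4) * Real.pi = d n := by
    rw [hzd n, hm, hφ]
    push_cast
    ring
  rw [e]
  exact hdn n hn2

/-- McMahon's asymptotics of the zeros, with the exact numbering. The possible shift of the
numbering is excluded for `1/2 < ν ≤ 3/2` by Sturm's comparison, and it does not change when `ν`
increases by `1`, since the zeros of `J_ν` and `J_{ν+1}` interlace. -/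
theorem exists_besselZero_asymptotic {ν : ℝ} (hν : 1 / 2 < ν) :
    ∃ E : ℝ, ∀ᶠ n : ℕ in atTop, |besselZero ν n - (n + ν / 2 - 1 / 4) * Real.pi| ≤ E / n := by
  have hpi := Real.pi_pos
  have hlim : ∀ (ν c E : ℝ), (∀ᶠ n : ℕ in atTop,
      |besselZero ν n - (n + c) * Real.pi| ≤ E / n) →
      Tendsto (fun n : ℕ => besselZero ν n - n * Real.pi) atTop (𝓝 (c * Real.pi)) :=
    fun ν c E h => by
      have h1 : Tendsto (fun n : ℕ => besselZero ν n - (n + c) * Real.pi) atTop (𝓝 0) :=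
        squeeze_zero_norm' h (tendsto_const_div_atTop_nhds_zero_nat E)
      have h2 := h1.add_const (c * Real.pi)
      rw [zero_add] at h2
      refine h2.congr fun n => ?_
      ring
  refine induction_on_order (P := fun ν => ∃ E : ℝ, ∀ᶠ n : ℕ in atTop,
    |besselZero ν n - (n + ν / 2 - 1 / 4) * Real.pi| ≤ E / n) (1 / 2)
    (fun ν h1 h2 => ?_) (fun ν h1 ih => ?_) hν
  · obtain ⟨N, E, hN⟩ := exists_besselZero_asymptotic_shift h1
    have ht := hlim ν (N + ν / 2 - 1 / 4) E
      (hN.mono fun n h => by convert! h using 3; ring)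
    have hge : 0 ≤ (N + ν / 2 - 1 / 4) * Real.pi :=
      ge_of_tendsto' ht fun n => sub_nonneg.mpr (mul_pi_le_besselZero h1 n)
    have hle : (N + ν / 2 - 1 / 4) * Real.pi ≤ Real.pi := by
      refine le_of_tendsto' ht fun n => ?_
      have h3 := besselZero_succ_order_lt (ν := ν - 1) (by linarith) n
      have h4 := besselZero_le_mul_pi (ν := ν - 1) (by linarith) (by linarith) (n + 1)
      rw [sub_add_cancel] at h3
      push_cast at h4
      linarith
    have hN0 : N = 0 := by
      have h5 : 0 ≤ (N : ℝ) + ν / 2 - 1 / 4 := nonneg_of_mul_nonneg_left hge hpi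
      have h6 : (N : ℝ) + ν / 2 - 1 / 4 ≤ 1 := by
        by_contra! hcon
        nlinarith
      have h7 : (-1 : ℝ) < N := by linarith
      have h8 : (N : ℝ) < 1 := by linarith
      have h7' : -1 < N := by exact_mod_cast h7
      have h8' : N < 1 := by exact_mod_cast h8
      omega
    subst hN0
    exact ⟨E, by simpa using hN⟩
  · obtain ⟨E₀, hE₀⟩ := ih
    obtain ⟨N, E, hN⟩ := exists_besselZero_asymptotic_shift (ν := ν + 1) (by linarith)
    have ht0 := hlim ν (ν / 2 - 1 / 4) E₀ (hE₀.mono fun n h => by convert! h using 3; ring)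
    have ht := hlim (ν + 1) (N + (ν + 1) / 2 - 1 / 4) E
      (hN.mono fun n h => by convert! h using 3; ring)
    have hge : (ν / 2 - 1 / 4) * Real.pi ≤ (N + (ν + 1) / 2 - 1 / 4) * Real.pi := by
      refine le_of_tendsto_of_tendsto ht0 ht ?_
      filter_upwards [eventually_ge_atTop 1] with n hn
      have := besselZero_lt_besselZero_succ_order (ν := ν) (by linarith) hn
      linarith
    have hle : (N + (ν + 1) / 2 - 1 / 4) * Real.pi ≤ (ν / 2 - 1 / 4) * Real.pi + Real.pi := by
      refine le_of_tendsto_of_tendsto' ht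
        (((tendsto_add_atTop_iff_nat 1).mpr ht0).add_const Real.pi) fun n => ?_
      have := besselZero_succ_order_lt (ν := ν) (by linarith) n
      push_cast
      linarith
    have hN0 : N = 0 := by
      have h5 : ν / 2 - 1 / 4 ≤ N + (ν + 1) / 2 - 1 / 4 := le_of_mul_le_mul_right hge hpi
      have h6 : N + (ν + 1) / 2 - 1 / 4 ≤ ν / 2 - 1 / 4 + 1 := by
        refine le_of_mul_le_mul_right ?_ hpi
        linarith
      have h7 : (-1 : ℝ) < N := by linarith
      have h8 : (N : ℝ) < 1 := by linarith
      have h7' : -1 < N := by exact_mod_cast h7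
      have h8' : N < 1 := by exact_mod_cast h8
      omega
    subst hN0
    exact ⟨E, by simpa using hN⟩

/-! ### The frequencies `ω_{α,n}` -/

theorem nu_add_one {α : ℝ} (hα : α < 2) : nu α + 1 = 1 / (2 - α) := by
  have : 2 - α ≠ 0 := by linarith
  unfold nu
  field_simp
  ring

theorem kappa_pos {α : ℝ} (hα : α < 2) : 0 < kappa α := by
  unfold kappa
  linarith

theorem sqrt_eigenvalue {α : ℝ} (hα : α < 2) (n : ℕ) :
    √(eigenvalue α n) = kappa α * besselZero (nu α + 1) n := by
  unfold eigenvalue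
  split_ifs with h
  · subst h
    simp [besselZero]
  · rw [← mul_pow, Real.sqrt_sq (mul_nonneg (kappa_pos hα).le (besselZero_nonneg _ _))]

theorem omega_natCast {α : ℝ} (hα : α < 2) (n : ℕ) :
    omega α n = kappa α * besselZero (nu α + 1) n := by
  unfold omega
  rw [if_neg (by omega)]
  split_ifs with h
  · have : n = 0 := by exact_mod_cast h
    subst this
    simp [besselZero]
  · rw [sqrt_eigenvalue hα, Int.natAbs_natCast]

theorem omega_neg_natCast {α : ℝ} (hα : α < 2) (n : ℕ) :
    omega α (-n) = -(kappa α * besselZero (nu α + 1) n) := by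
  rcases Nat.eq_zero_or_pos n with rfl | hn
  · simp [omega, besselZero]
  · unfold omega
    rw [if_pos (by omega), sqrt_eigenvalue hα, Int.natAbs_neg, Int.natAbs_natCast]

theorem strictMono_omega {α : ℝ} (hα : α < 2) (hν : -(1 / 2) < nu α + 1) :
    StrictMono (omega α) := by
  refine strictMono_int_of_lt_succ fun n => ?_
  have hz := besselZero_lt_succ hν
  have hk := kappa_pos hα
  rcases Int.le_total 0 n with h | h
  · obtain ⟨m, rfl⟩ := Int.eq_ofNat_of_zero_le h
    have e : (m : ℤ) + 1 = ((m + 1 : ℕ) : ℤ) := by push_cast; ring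
    rw [e, omega_natCast hα, omega_natCast hα]
    exact mul_lt_mul_of_pos_left (hz m) hk
  · obtain ⟨m, hm⟩ := Int.eq_ofNat_of_zero_le (neg_nonneg.mpr h)
    rcases Nat.eq_zero_or_pos m with rfl | hm0
    · have hn : n = ((0 : ℕ) : ℤ) := by simpa using hm
      have e : n + 1 = ((1 : ℕ) : ℤ) := by rw [hn]; rfl
      rw [e, hn, omega_natCast hα, omega_natCast hα]
      exact mul_lt_mul_of_pos_left (hz 0) hk
    · obtain ⟨l, rfl⟩ := Nat.exists_eq_succ_of_ne_zero hm0.ne'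
      have hn : n = -((l + 1 : ℕ) : ℤ) := by rw [← neg_neg n, hm]
      have e : n + 1 = -((l : ℕ) : ℤ) := by rw [hn]; push_cast; ring
      rw [e, hn, omega_neg_natCast hα, omega_neg_natCast hα]
      exact neg_lt_neg (mul_lt_mul_of_pos_left (hz l) hk)

/-- The bijection `ℤ ⊕ Fin k ≃ ℤ` that moves the negative integers down by `k` and puts `Fin k`
into the gap. -/
def gapMap (k : ℕ) : ℤ ⊕ Fin k → ℤ :=
  Sum.elim (fun n => if 0 ≤ n then n else n - k) fun j => -1 - (j : ℤ)

theorem gapMap_bijective (k : ℕ) : Function.Bijective (gapMap k) := by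
  constructor
  · rintro (m | i) (n | j) h <;> simp only [gapMap, Sum.elim_inl, Sum.elim_inr] at h
    · have : m = n := by split_ifs at h <;> omega
      rw [this]
    · have := j.2
      split_ifs at h <;> omega
    · have := i.2
      split_ifs at h <;> omega
    · congr 1
      ext
      omega
  · intro n
    by_cases h0 : 0 ≤ n
    · exact ⟨Sum.inl n, by simp [gapMap, h0]⟩
    · by_cases hk : n < -k
      · refine ⟨Sum.inl (n + k), ?_⟩
        simp only [gapMap, Sum.elim_inl]
        rw [if_neg (by omega)]
        omega
      · refine ⟨Sum.inr ⟨(-1 - n).toNat, by omega⟩, ?_⟩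
        simp only [gapMap, Sum.elim_inr]
        omega

/-- The frequencies `ω_{α,n}`, renumbered with room for `k` further ones, approach
`2π/T₀ (n + k/2 ± δ)` in `ℓ²`, where `δ = μ/2 - 1/4 - k/2` and `μ = 1/(2 - α)`. -/
theorem summable_sq_omega_sub {α : ℝ} (hα1 : 1 ≤ α) (hα : α < 2) (k : ℕ) {σ : ℤ → ℝ}
    (hpos : ∀ n : ℤ, 0 ≤ n → σ n = omega α n) (hneg : ∀ n : ℤ, n < 0 → σ (n - k) = omega α n)
    {δ : ℝ} (hδ : δ = 1 / (2 - α) / 2 - 1 / 4 - k / 2) :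
    Summable fun n : ℤ => (σ n - 2 * Real.pi / T0 α *
      (n + (k : ℝ) / 2 + if 0 ≤ n then δ else -δ)) ^ 2 := by
  have h2 : 0 < 2 - α := by linarith
  have hμ : 1 ≤ 1 / (2 - α) := by rw [le_div_iff₀ h2]; linarith
  obtain ⟨E, hE⟩ := exists_besselZero_asymptotic (ν := nu α + 1)
    (by rw [nu_add_one hα]; linarith)
  have hunit : 2 * Real.pi / T0 α = kappa α * Real.pi := by
    unfold T0 kappa
    field_simp
    norm_num
  have hnat : Summable fun n : ℕ => (kappa α * besselZero (nu α + 1) n -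
      kappa α * Real.pi * (n + (k : ℝ) / 2 + δ)) ^ 2 := by
    refine Summable.of_norm_bounded_eventually_nat
      (g := fun n : ℕ => (kappa α * E) ^ 2 * (1 / (n : ℝ) ^ 2))
      ((Real.summable_one_div_nat_pow.mpr one_lt_two).mul_left _) ?_
    filter_upwards [hE] with n hn
    have e : kappa α * besselZero (nu α + 1) n - kappa α * Real.pi * (n + (k : ℝ) / 2 + δ) =
        kappa α * (besselZero (nu α + 1) n - (n + (nu α + 1) / 2 - 1 / 4) * Real.pi) := by
      rw [hδ, nu_add_one hα]
      ring
    rw [e, Real.norm_of_nonneg (sq_nonneg _), mul_pow, ← sq_abs (besselZero _ _ - _)]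
    calc kappa α ^ 2 * |besselZero (nu α + 1) n - (n + (nu α + 1) / 2 - 1 / 4) * Real.pi| ^ 2
        ≤ kappa α ^ 2 * (E / n) ^ 2 := by gcongr
      _ = (kappa α * E) ^ 2 * (1 / (n : ℝ) ^ 2) := by ring
  rw [hunit]
  refine Summable.of_nat_of_neg ?_ ?_
  · refine hnat.congr fun n => ?_
    rw [hpos n (by omega), omega_natCast hα, if_pos (by omega), Int.cast_natCast]
  · rw [← summable_nat_add_iff (k + 1)]
    refine ((summable_nat_add_iff 1).mpr hnat).congr fun n => ?_
    have e : -((n + (k + 1) : ℕ) : ℤ) = -((n + 1 : ℕ) : ℤ) - k := by push_cast; ring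
    rw [e, hneg _ (by omega), omega_neg_natCast hα, if_neg (by omega)]
    push_cast
    ring

end BesselZeros

end DegenerateWave

end


theorem lemma7p6 (α : ℝ) (hα : α ∈ Set.Ico (1 : ℝ) 2)
    (hα_nat : ∀ m : ℕ, 1 / (2 - α) ≠ (m : ℝ)) :
    (∃ x : Fin ⌊1 / (2 - α)⌋₊ → ℝ,
      DegenerateWave.IsRieszBasis
        (Sum.elim
          (fun n : ℤ => DegenerateWave.expL2 (DegenerateWave.T0 α) (DegenerateWave.omega α n))
          (fun j => DegenerateWave.expL2 (DegenerateWave.T0 α) (x j)))) ∧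
    DegenerateWave.HasDeficiency
      (fun n : ℤ => DegenerateWave.expL2 (DegenerateWave.T0 α) (DegenerateWave.omega α n))
      ⌊1 / (2 - α)⌋₊ := by
  obtain ⟨hα1, hα2⟩ := hα
  have h2 : 0 < 2 - α := by linarith
  have hμ : 1 ≤ 1 / (2 - α) := by rw [le_div_iff₀ h2]; linarith
  have hT : 0 < DegenerateWave.T0 α := by unfold DegenerateWave.T0; positivity
  set k := ⌊1 / (2 - α)⌋₊ with hk
  have hk1 : (k : ℝ) < 1 / (2 - α) :=
    lt_of_le_of_ne (Nat.floor_le (by linarith)) (hα_nat k).symm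
  have hk2 : 1 / (2 - α) < k + 1 := Nat.lt_floor_add_one _
  have hωinj : Function.Injective (DegenerateWave.omega α) :=
    (DegenerateWave.strictMono_omega hα2
      (by rw [DegenerateWave.nu_add_one hα2]; linarith)).injective
  -- any distinct real numbers outside the given frequencies may be adjoined
  have hinf := DegenerateWave.infinite_compl_of_countable
    (Set.countable_range (DegenerateWave.omega α))
  have := hinf.to_subtype
  let y : ℕ ↪ ↥(Set.range (DegenerateWave.omega α))ᶜ := Infinite.natEmbedding _
  let x : Fin k → ℝ := fun j => y j
  have hxinj : Function.Injective x := fun i j hij =>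
    Fin.ext (y.injective (Subtype.ext hij))
  have hinj : Function.Injective (Sum.elim (DegenerateWave.omega α) x) :=
    hωinj.sumElim hxinj fun n j h => (y j).2 ⟨n, h⟩
  let e : ℤ ⊕ Fin k ≃ ℤ := Equiv.ofBijective _ (DegenerateWave.gapMap_bijective k)
  let σ : ℤ → ℝ := fun n => Sum.elim (DegenerateWave.omega α) x (e.symm n)
  have hσ : ∀ i, σ (e i) = Sum.elim (DegenerateWave.omega α) x i := fun i => by
    simp only [σ, Equiv.symm_apply_apply]
  have hbasis : DegenerateWave.IsRieszBasis
      fun n => DegenerateWave.expL2 (DegenerateWave.T0 α) (σ n) := by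
    refine DegenerateWave.isRieszBasis_expL2_of_summable hT (k / 2)
      (δ := 1 / (2 - α) / 2 - 1 / 4 - k / 2) ?_ (hinj.comp e.symm.injective)
      (DegenerateWave.summable_sq_omega_sub hα1 hα2 k (fun n hn => ?_) (fun n hn => ?_) rfl)
    · rw [abs_lt]
      constructor <;> linarith
    · have he : e (Sum.inl n) = n := by
        change DegenerateWave.gapMap k (Sum.inl n) = n
        simp [DegenerateWave.gapMap, hn]
      have := hσ (Sum.inl n)
      rwa [he] at this
    · have he : e (Sum.inl n) = n - k := by
        change DegenerateWave.gapMap k (Sum.inl n) = n - k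
        simp [DegenerateWave.gapMap, not_le.mpr hn]
      have := hσ (Sum.inl n)
      rwa [he] at this
  have hR : DegenerateWave.IsRieszBasis (Sum.elim
      (fun n : ℤ => DegenerateWave.expL2 (DegenerateWave.T0 α) (DegenerateWave.omega α n))
      (fun j => DegenerateWave.expL2 (DegenerateWave.T0 α) (x j))) := by
    convert! hbasis.reindex e using 1
    ext1 i
    rw [hσ]
    rcases i with n | j <;> rfl
  exact ⟨⟨x, hR⟩, hR.hasDeficiency⟩
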